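/- Let $L\le M\le N$ be nonnegative integers and let $s\in\{2,4,6,\ldots\}\cup\{\infty\}$. All $C^*$-algebras and morphisms are unital, $\otimes$ is the maximal tensor product, and for a matrix $u=(u_{ij})$ we write $\bar u=(u_{ij}^*)$. Define: - $C(U_{MN}^{L+})$ is the universal $C^*$-algebra generated by the entries of an $M\times N$ matrix $u=(u_{ij})$, with the relations saying that $uu^*$ and $\bar u u^t$ are projections of trace $L$ (the trace being the sum of the diagonal entries). - $C(H_{MN}^{sL+})$ is the quotient of $C(U_{MN}^{L+})$ by the relations $u_{ij}u_{ij}^*=u_{ij}^*u_{ij}=p_{ij}$ with each $p_{ij}$ a projection, and $u_{ij}^s=p_{ij}$ (this last relation being dropped when $s=\infty$). - $C(H_N^{s+})$ is the universal $C^*$-algebra generated by the entries of an $N\times N$ matrix $u=(u_{ij})$ with the same relations $u_{ij}u_{ij}^*=u_{ij}^*u_{ij}=p_{ij}$, $p_{ij}$ projections, $u_{ij}^s=p_{ij}$ (dropped when $s=\infty$), and with $\sum_jp_{ij}=1$ for each $i$ and $\sum_ip_{ij}=1$ for each $j$; its comultiplication and counit are given by $\Delta(u_{ij})=\sum_ku_{ik}\otimes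 u_{kj}$ and $\varepsilon(u_{ij})=\delta_{ij}$. Let $G=H_M^{s+}\times H_N^{s+}$, that is, $C(G)=C(H_M^{s+})\otimes C(H_N^{s+})$ with the product comultiplication (the two comultiplications, followed by the flip of the two middle tensor factors) and the product counit, and let $a_{ij},b_{ij}$ be the standard generators of $C(H_M^{s+})$ and $C(H_N^{s+})$. Let $X=H_{MN}^{sL+}$. Then: 1. (Action map) There is a $*$-homomorphism $\Phi:C(X)\to C(G)\otimes C(X)$ with $$\Phi(u_{ij})=\sum_{k=1}^M\sum_{l=1}^N a_{ik}\otimes b_{jl}^*\otimes u_{kl},$$ and $\Phi$ is a coaction: $(\Delta\otimes id)\Phi=(id\otimes\Phi)\Phi$, $(\varepsilon\otimes id)\Phi=id$, and the linear span of $\Phi(C(X))(C(G)\otimes1)$ is dense in $C(G)\otimes C(X)$. 2. (Quotient map) There is a $*$-homomorphism $\pi:C(X)\to C(G)$ with $$\pi(u_{ij})=\sum_{l=1}^L a_{il}\otimes b_{jl}^*.$$ 3. (Compatibility) These satisfy $(id\otimes\pi)\Phi=\Delta\pi$. -/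

import Mathlib

open scoped TensorProduct
open UniformSpace

noncomputable section

namespace FreeSpaces

/-! ### Universal C*-algebras -/

/-- The possible values `‖π a‖`, for `π` a unital *-homomorphism from the *-algebra `A` to a
C*-algebra that turns the relations `R` into equalities. Since the closure of the range of `π` is
again a C*-algebra, it is no restriction to take `B` in the same universe as `A`. -/
def repNorms {A : Type} [Ring A] [StarRing A] [Algebra ℂ A] (R : A → A → Prop) (a : A) : Set ℝ :=
  {r | ∃ (B : Type) (_ : CStarAlgebra B) (π : A →⋆ₐ[ℂ] B),
    (∀ x y, R x y → π x = π y) ∧ r = ‖π a‖}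

/-- The relations `R` admit a universal C*-algebra: every element of `A` is uniformly bounded
in the representations that satisfy `R`. -/
def IsBddRel {A : Type} [Ring A] [StarRing A] [Algebra ℂ A] (R : A → A → Prop) : Prop :=
  ∀ a, BddAbove (repNorms R a)

/-- The *-algebra `A`, as the carrier of the largest C*-seminorm that is compatible with `R`. -/
@[nolint unusedArguments]
def PreUniv {A : Type} [Ring A] [StarRing A] [Algebra ℂ A] (R : A → A → Prop)
    (_ : IsBddRel R) : Type := A

section Seminorm

variable {A : Type} [Ring A] [StarRing A] [Algebra ℂ A] {R : A → A → Prop} (hR : IsBddRel R)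

/-- The largest C*-seminorm on `A` that is compatible with `R`. -/
def univSeminorm : RingSeminorm A where
  toFun a := sSup (repNorms R a)
  map_zero' := by
    refine le_antisymm (Real.sSup_le ?_ le_rfl) (Real.sSup_nonneg ?_)
    · rintro r ⟨B, _, π, -, rfl⟩; simp
    · rintro r ⟨B, _, π, -, rfl⟩; simp
  add_le' a b := by
    have h0 : ∀ c, 0 ≤ sSup (repNorms R c) := fun c => Real.sSup_nonneg (by
      rintro r ⟨B, _, π, -, rfl⟩; exact norm_nonneg _)
    refine Real.sSup_le ?_ (add_nonneg (h0 a) (h0 b))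
    rintro r ⟨B, _, π, hπ, rfl⟩
    rw [map_add]
    exact (norm_add_le _ _).trans (add_le_add (le_csSup (hR a) ⟨B, _, π, hπ, rfl⟩)
      (le_csSup (hR b) ⟨B, _, π, hπ, rfl⟩))
  neg' a := by
    have : repNorms R (-a) = repNorms R a := by simp [repNorms]
    rw [this]
  mul_le' a b := by
    have h0 : ∀ c, 0 ≤ sSup (repNorms R c) := fun c => Real.sSup_nonneg (by
      rintro r ⟨B, _, π, -, rfl⟩; exact norm_nonneg _)
    refine Real.sSup_le ?_ (mul_nonneg (h0 a) (h0 b))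
    rintro r ⟨B, _, π, hπ, rfl⟩
    rw [map_mul]
    exact (norm_mul_le _ _).trans (mul_le_mul (le_csSup (hR a) ⟨B, _, π, hπ, rfl⟩)
      (le_csSup (hR b) ⟨B, _, π, hπ, rfl⟩) (norm_nonneg _) (h0 a))

/-- The identity map `A → PreUniv R hR`. -/
def toPre (a : A) : PreUniv R hR := a

instance : Ring (PreUniv R hR) := inferInstanceAs (Ring A)
instance : StarRing (PreUniv R hR) := inferInstanceAs (StarRing A)
instance : Algebra ℂ (PreUniv R hR) := inferInstanceAs (Algebra ℂ A)

/-- `univSeminorm`, transported to the synonym. -/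
def preSeminorm : RingSeminorm (PreUniv R hR) where
  toFun a := univSeminorm (A := A) hR a
  map_zero' := (univSeminorm (A := A) hR).map_zero'
  add_le' := (univSeminorm (A := A) hR).add_le'
  neg' := (univSeminorm (A := A) hR).neg'
  mul_le' := (univSeminorm (A := A) hR).mul_le'

instance : SeminormedRing (PreUniv R hR) := (preSeminorm hR).toSeminormedRing

theorem norm_toPre (a : A) : ‖toPre hR a‖ = sSup (repNorms R a) := rfl

theorem norm_rep_le {B : Type} [CStarAlgebra B] (π : A →⋆ₐ[ℂ] B)
    (hπ : ∀ x y, R x y → π x = π y) (a : A) : ‖π a‖ ≤ ‖toPre hR a‖ :=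
  le_csSup (hR a) ⟨B, _, π, hπ, rfl⟩

theorem norm_toPre_le {a : A} {C : ℝ} (hC : 0 ≤ C)
    (h : ∀ (B : Type) [CStarAlgebra B] (π : A →⋆ₐ[ℂ] B), (∀ x y, R x y → π x = π y) → ‖π a‖ ≤ C) :
    ‖toPre hR a‖ ≤ C := by
  refine Real.sSup_le ?_ hC
  rintro r ⟨B, _, π, hπ, rfl⟩
  exact h B π hπ

theorem norm_toPre_smul (c : ℂ) (a : A) : ‖toPre hR (c • a)‖ ≤ ‖c‖ * ‖toPre hR a‖ := by
  refine norm_toPre_le hR (by positivity) fun B _ π hπ => ?_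
  rw [map_smul, norm_smul]
  exact mul_le_mul_of_nonneg_left (norm_rep_le hR π hπ a) (norm_nonneg _)

theorem norm_toPre_star (a : A) : ‖toPre hR (star a)‖ ≤ ‖toPre hR a‖ := by
  refine norm_toPre_le hR (norm_nonneg _) fun B _ π hπ => ?_
  rw [map_star, norm_star]
  exact norm_rep_le hR π hπ a

theorem norm_toPre_mul_self (a : A) :
    ‖toPre hR a‖ * ‖toPre hR a‖ ≤ ‖toPre hR (star a * a)‖ := by
  have h : ‖toPre hR a‖ ≤ √‖toPre hR (star a * a)‖ := by
    refine norm_toPre_le hR (Real.sqrt_nonneg _) fun B _ π hπ => Real.le_sqrt_of_sq_le ?_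
    have h := norm_rep_le hR π hπ (star a * a)
    rw [map_mul, map_star, CStarRing.norm_star_mul_self] at h
    rw [sq]
    exact h
  calc ‖toPre hR a‖ * ‖toPre hR a‖ ≤ √‖toPre hR (star a * a)‖ * √‖toPre hR (star a * a)‖ := by
        gcongr
    _ = _ := Real.mul_self_sqrt (norm_nonneg _)

instance : NormedAlgebra ℂ (PreUniv R hR) where
  norm_smul_le c a := norm_toPre_smul hR c a

instance : NormedStarGroup (PreUniv R hR) where
  norm_star_le a := norm_toPre_star hR a

end Seminorm

/-- The universal C*-algebra generated by the *-algebra `A` subject to the relations `R`: the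
separated completion of `A` for the largest C*-seminorm that is compatible with `R`. When `A` is
itself a C*-algebra, this is the quotient of `A` by the closed two-sided ideal generated by the
differences `x - y`, where `R x y`. -/
def UnivCStar {A : Type} [Ring A] [StarRing A] [Algebra ℂ A] (R : A → A → Prop)
    (hR : IsBddRel R) : Type := Completion (PreUniv R hR)

namespace UnivCStar

section

variable {A : Type} [Ring A] [StarRing A] [Algebra ℂ A] {R : A → A → Prop} (hR : IsBddRel R)

instance : NormedRing (UnivCStar R hR) := inferInstanceAs (NormedRing (Completion (PreUniv R hR)))
instance : CompleteSpace (UnivCStar R hR) :=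
  inferInstanceAs (CompleteSpace (Completion (PreUniv R hR)))
instance : Algebra ℂ (UnivCStar R hR) :=
  inferInstanceAs (Algebra ℂ (Completion (PreUniv R hR)))

/-- The canonical map from the *-algebra to the universal C*-algebra, as a plain function. -/
def mkFun (a : A) : UnivCStar R hR := ((toPre hR a : PreUniv R hR) : Completion (PreUniv R hR))

theorem mkFun_zero : mkFun hR 0 = 0 := Completion.coe_zero
theorem mkFun_one : mkFun hR 1 = 1 := Completion.coe_one _
theorem mkFun_add (a b : A) : mkFun hR (a + b) = mkFun hR a + mkFun hR b :=
  Completion.coe_add (toPre hR a) (toPre hR b)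
theorem mkFun_mul (a b : A) : mkFun hR (a * b) = mkFun hR a * mkFun hR b :=
  Completion.coe_mul (toPre hR a) (toPre hR b)
theorem mkFun_smul (c : ℂ) (a : A) : mkFun hR (c • a) = c • mkFun hR a :=
  Completion.coe_smul c (toPre hR a)
theorem norm_mkFun (a : A) : ‖mkFun hR a‖ = ‖toPre hR a‖ := Completion.norm_coe (toPre hR a)

theorem denseRange_mkFun : DenseRange (mkFun hR) :=
  Completion.denseRange_coe (α := PreUniv R hR)

instance : NormedAlgebra ℂ (UnivCStar R hR) where
  norm_smul_le c x := by
    refine (denseRange_mkFun hR).induction_on x ?_ fun a => ?_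
    · exact isClosed_le (continuous_norm.comp (uniformContinuous_const_smul
        (X := Completion (PreUniv R hR)) c).continuous) (by fun_prop)
    · rw [← mkFun_smul, norm_mkFun, norm_mkFun]
      exact norm_toPre_smul hR c a

instance : Star (UnivCStar R hR) :=
  ⟨fun x => Completion.map (star : PreUniv R hR → PreUniv R hR) x⟩

theorem mkFun_star (a : A) : mkFun hR (star a) = star (mkFun hR a) :=
  (Completion.map_coe (star_isometry (E := PreUniv R hR)).uniformContinuous (toPre hR a)).symm

theorem continuous_star' : Continuous (star : UnivCStar R hR → UnivCStar R hR) :=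
  Completion.continuous_map

instance : StarRing (UnivCStar R hR) where
  star_involutive x := by
    refine (denseRange_mkFun hR).induction_on x ?_ fun a => ?_
    · exact isClosed_eq ((continuous_star' hR).comp (continuous_star' hR)) continuous_id
    · rw [← mkFun_star, ← mkFun_star, star_star]
  star_mul x y := by
    refine (denseRange_mkFun hR).induction_on₂ (p := fun x y => star (x * y) = star y * star x)
      ?_ (fun a b => ?_) x y
    · exact isClosed_eq ((continuous_star' hR).comp continuous_mul)
        (((continuous_star' hR).comp continuous_snd).mul ((continuous_star' hR).comp continuous_fst))
    · rw [← mkFun_mul, ← mkFun_star, ← mkFun_star, ← mkFun_star, star_mul, mkFun_mul]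
  star_add x y := by
    refine (denseRange_mkFun hR).induction_on₂ (p := fun x y => star (x + y) = star x + star y)
      ?_ (fun a b => ?_) x y
    · exact isClosed_eq ((continuous_star' hR).comp continuous_add)
        (((continuous_star' hR).comp continuous_fst).add ((continuous_star' hR).comp continuous_snd))
    · rw [← mkFun_add, ← mkFun_star, ← mkFun_star, ← mkFun_star, star_add, mkFun_add]

instance : CStarRing (UnivCStar R hR) where
  norm_mul_self_le x := by
    refine (denseRange_mkFun hR).induction_on x ?_ fun a => ?_
    · exact isClosed_le (by fun_prop)
        (continuous_norm.comp ((continuous_star' hR).mul continuous_id))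
    · rw [← mkFun_star, ← mkFun_mul, norm_mkFun, norm_mkFun]
      exact norm_toPre_mul_self hR a

/-- The canonical map from the *-algebra to the universal C*-algebra. -/
def mk : A →⋆ₐ[ℂ] UnivCStar R hR where
  toFun := mkFun hR
  map_one' := mkFun_one hR
  map_mul' := mkFun_mul hR
  map_zero' := mkFun_zero hR
  map_add' := mkFun_add hR
  commutes' c := by
    rw [Algebra.algebraMap_eq_smul_one, mkFun_smul, mkFun_one, ← Algebra.algebraMap_eq_smul_one]
  map_star' := mkFun_star hR

theorem denseRange_mk : DenseRange (mk hR) := denseRange_mkFun hR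

theorem norm_mk_le {a : A} {C : ℝ} (hC : 0 ≤ C)
    (h : ∀ (B : Type) [CStarAlgebra B] (π : A →⋆ₐ[ℂ] B), (∀ x y, R x y → π x = π y) → ‖π a‖ ≤ C) :
    ‖mk hR a‖ ≤ C := (norm_mkFun hR a).trans_le (norm_toPre_le hR hC h)

theorem mk_eq_of_rel {x y : A} (h : R x y) : mk hR x = mk hR y := by
  rw [← sub_eq_zero, ← norm_le_zero_iff, ← map_sub]
  refine norm_mk_le hR le_rfl fun B _ π hπ => ?_
  rw [map_sub, hπ x y h, sub_self, norm_zero]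

/-- `π`, as a ring homomorphism on the synonym. -/
def liftPre {B : Type} [CStarAlgebra B] (π : A →⋆ₐ[ℂ] B) : PreUniv R hR →+* B where
  toFun a := π a
  map_one' := map_one π
  map_mul' := map_mul π
  map_zero' := map_zero π
  map_add' := map_add π

theorem continuous_liftPre {B : Type} [CStarAlgebra B] (π : A →⋆ₐ[ℂ] B)
    (hπ : ∀ x y, R x y → π x = π y) : Continuous (liftPre hR π) :=
  AddMonoidHomClass.continuous_of_bound _ 1 fun a => by
    rw [one_mul]; exact norm_rep_le hR π hπ a

/-- Universal property: a *-homomorphism from `A` to a C*-algebra that turns the relations into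
equalities factors through the universal C*-algebra. -/
def lift {B : Type} [CStarAlgebra B] (π : A →⋆ₐ[ℂ] B) (hπ : ∀ x y, R x y → π x = π y) :
    UnivCStar R hR →⋆ₐ[ℂ] B :=
  let g : UnivCStar R hR →+* B :=
    Completion.extensionHom (liftPre hR π) (continuous_liftPre hR π hπ)
  have hg : ∀ a, g (mkFun hR a) = π a := fun a =>
    Completion.extensionHom_coe (liftPre hR π) (continuous_liftPre hR π hπ) (toPre hR a)
  have hgc : Continuous g := Completion.continuous_extension
  { g with
    commutes' := fun c => by
      have : algebraMap ℂ (UnivCStar R hR) c = mkFun hR (algebraMap ℂ A c) := by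
        rw [Algebra.algebraMap_eq_smul_one, Algebra.algebraMap_eq_smul_one, mkFun_smul, mkFun_one]
      refine (congrArg g this).trans ((hg _).trans (AlgHomClass.commutes π c))
    map_star' := fun x => by
      change g (star x) = star (g x)
      refine (denseRange_mkFun hR).induction_on x ?_ fun a => ?_
      · exact isClosed_eq (hgc.comp (continuous_star' hR)) (continuous_star.comp hgc)
      · rw [← mkFun_star, hg, hg, map_star] }

@[simp]
theorem lift_mk {B : Type} [CStarAlgebra B] (π : A →⋆ₐ[ℂ] B) (hπ : ∀ x y, R x y → π x = π y)
    (a : A) : lift hR π hπ (mk hR a) = π a :=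
  Completion.extensionHom_coe (liftPre hR π) (continuous_liftPre hR π hπ) (toPre hR a)

end

section

variable {A : Type} [Ring A] [StarRing A] [Algebra ℂ A] [StarModule ℂ A] {R : A → A → Prop}
  (hR : IsBddRel R)

instance : StarModule ℂ (UnivCStar R hR) where
  star_smul c x := by
    refine (denseRange_mkFun hR).induction_on x ?_ fun a => ?_
    · exact isClosed_eq ((continuous_star' hR).comp (continuous_const_smul c))
        ((continuous_const_smul (star c)).comp (continuous_star' hR))
    · rw [← mkFun_smul, ← mkFun_star, ← mkFun_star, star_smul, mkFun_smul]

instance : CStarAlgebra (UnivCStar R hR) where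

end
end UnivCStar
end FreeSpaces

namespace FreeSpaces

theorem norm_one_le_one (B : Type) [CStarAlgebra B] : ‖(1 : B)‖ ≤ 1 := by
  rcases subsingleton_or_nontrivial B with h | h
  · rw [Subsingleton.elim (1 : B) 0, norm_zero]; exact zero_le_one
  · rw [CStarRing.norm_one]

/-! ### The free *-algebra -/

/-- The free unital complex *-algebra on a set `X`: the monoid algebra of the free monoid on the
letters `x = inl x` and `x* = inr x`. -/
def FreeStar (X : Type) : Type := MonoidAlgebra ℂ (FreeMonoid (X ⊕ X))

namespace FreeStar

variable {X : Type}

instance : Ring (FreeStar X) := inferInstanceAs (Ring (MonoidAlgebra ℂ (FreeMonoid (X ⊕ X))))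
instance : Algebra ℂ (FreeStar X) :=
  inferInstanceAs (Algebra ℂ (MonoidAlgebra ℂ (FreeMonoid (X ⊕ X))))

/-- A word in the letters `x`, `x*`, as a monomial. -/
def word : FreeMonoid (X ⊕ X) →* FreeStar X := MonoidAlgebra.of ℂ (FreeMonoid (X ⊕ X))

/-- The generators of the free *-algebra. -/
def gen (x : X) : FreeStar X := word (FreeMonoid.of (Sum.inl x))

theorem induction {p : FreeStar X → Prop} (a : FreeStar X) (hw : ∀ w, p (word w))
    (hadd : ∀ a b, p a → p b → p (a + b)) (hsmul : ∀ (c : ℂ) a, p a → p (c • a)) : p a :=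
  MonoidAlgebra.induction_on (motive := p) a hw hadd hsmul

theorem ringHom_ext {S : Type} [Semiring S] {f g : FreeStar X →+* S}
    (hc : ∀ c : ℂ, f (algebraMap ℂ _ c) = g (algebraMap ℂ _ c))
    (hx : ∀ y, f (word (FreeMonoid.of y)) = g (word (FreeMonoid.of y))) : f = g := by
  have hw : (f : FreeStar X →* S).comp word = (g : FreeStar X →* S).comp word :=
    FreeMonoid.hom_eq hx
  ext a
  refine induction (p := fun a => f a = g a) a (fun w => DFunLike.congr_fun hw w) ?_ ?_
  · intro a b ha hb; rw [map_add, map_add, ha, hb]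
  · intro c a ha; rw [Algebra.smul_def, map_mul, map_mul, ha, hc]

/-- The conjugate-linear antiautomorphism exchanging the letters `x` and `x*`, as a ring
homomorphism to the opposite algebra. -/
def starHom : FreeStar X →+* (FreeStar X)ᵐᵒᵖ :=
  MonoidAlgebra.liftNCRingHom
    (((algebraMap ℂ (FreeStar X)ᵐᵒᵖ)).comp (starRingEnd ℂ))
    (FreeMonoid.lift fun y => MulOpposite.op (word (FreeMonoid.of y.swap)))
    (fun c _ => Algebra.commutes (A := (FreeStar X)ᵐᵒᵖ) (starRingEnd ℂ c) _)

theorem starHom_word_of (y : X ⊕ X) :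
    starHom (word (FreeMonoid.of y)) = MulOpposite.op (word (FreeMonoid.of y.swap)) := by
  refine (MonoidAlgebra.liftNC_single _ _ _ _).trans ?_
  simp

theorem starHom_algebraMap (c : ℂ) :
    starHom (algebraMap ℂ (FreeStar X) c) = algebraMap ℂ (FreeStar X)ᵐᵒᵖ (starRingEnd ℂ c) := by
  refine (MonoidAlgebra.liftNC_single _ _ _ _).trans ?_
  simp

theorem starHom_starHom (a : FreeStar X) :
    MulOpposite.unop (starHom (MulOpposite.unop (starHom a))) = a := by
  let f : FreeStar X →+* FreeStar X :=
    { toFun := fun a => MulOpposite.unop (starHom (MulOpposite.unop (starHom a)))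
      map_one' := by simp
      map_mul' := by simp
      map_zero' := by simp
      map_add' := by simp }
  have : f = RingHom.id _ := by
    refine ringHom_ext (fun c => ?_) (fun y => ?_)
    · change MulOpposite.unop (starHom (MulOpposite.unop (starHom _))) = _
      rw [starHom_algebraMap, MulOpposite.algebraMap_apply, MulOpposite.unop_op,
        starHom_algebraMap, MulOpposite.algebraMap_apply, MulOpposite.unop_op]
      simp
    · change MulOpposite.unop (starHom (MulOpposite.unop (starHom _))) = _
      rw [starHom_word_of, MulOpposite.unop_op, starHom_word_of, MulOpposite.unop_op,
        Sum.swap_swap]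
      rfl
  exact DFunLike.congr_fun this a

instance : StarRing (FreeStar X) where
  star a := MulOpposite.unop (starHom a)
  star_involutive := starHom_starHom
  star_mul a b := by simp
  star_add a b := by simp

theorem star_word_of (y : X ⊕ X) :
    star (word (FreeMonoid.of y) : FreeStar X) = word (FreeMonoid.of y.swap) :=
  congrArg MulOpposite.unop (starHom_word_of y)

theorem star_algebraMap (c : ℂ) :
    star (algebraMap ℂ (FreeStar X) c) = algebraMap ℂ (FreeStar X) (star c) :=
  congrArg MulOpposite.unop (starHom_algebraMap c)

instance : StarModule ℂ (FreeStar X) where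
  star_smul c a := by
    rw [Algebra.smul_def, star_mul, star_algebraMap, Algebra.smul_def, Algebra.commutes]

/-- The *-homomorphism from the free *-algebra determined by the images of the generators. -/
def lift {B : Type} [Ring B] [StarRing B] [Algebra ℂ B] [StarModule ℂ B] (f : X → B) :
    FreeStar X →⋆ₐ[ℂ] B :=
  let g : FreeStar X →ₐ[ℂ] B := MonoidAlgebra.lift ℂ B (FreeMonoid (X ⊕ X))
    (FreeMonoid.lift (Sum.elim f fun x => star (f x)))
  have hg : ∀ y, g (word (FreeMonoid.of y)) = Sum.elim f (fun x => star (f x)) y := fun y =>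
    (MonoidAlgebra.lift_of _ _).trans (FreeMonoid.lift_eval_of _ _)
  { g with
    map_star' := fun a => by
      change g (star a) = star (g a)
      let h : FreeStar X →+* B :=
        { toFun := fun a => star (g (star a))
          map_one' := by simp
          map_mul' := by simp
          map_zero' := by simp
          map_add' := by simp }
      have : h = g.toRingHom := by
        refine ringHom_ext (fun c => ?_) (fun y => ?_)
        · change star (g (star (algebraMap ℂ (FreeStar X) c))) = g (algebraMap ℂ (FreeStar X) c)
          rw [star_algebraMap, AlgHom.commutes, AlgHom.commutes, ← algebraMap_star_comm, star_star]
        · change star (g (star _)) = g _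
          rw [star_word_of, hg, hg]
          cases y <;> simp
      have h2 : star (g (star a)) = g a := DFunLike.congr_fun this a
      rw [← h2, star_star] }

@[simp]
theorem lift_gen {B : Type} [Ring B] [StarRing B] [Algebra ℂ B] [StarModule ℂ B] (f : X → B)
    (x : X) : lift f (gen x) = f x :=
  (MonoidAlgebra.lift_of _ _).trans (FreeMonoid.lift_eval_of _ _)

/-- A relation on the free *-algebra that bounds the generators admits a universal C*-algebra. -/
theorem isBddRel {R : FreeStar X → FreeStar X → Prop} (C : X → ℝ)
    (h : ∀ (x : X) (B : Type) [CStarAlgebra B] (π : FreeStar X →⋆ₐ[ℂ] B),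
      (∀ a b, R a b → π a = π b) → ‖π (gen x)‖ ≤ C x) : IsBddRel R := by
  suffices H : ∀ a : FreeStar X, ∃ K : ℝ, ∀ (B : Type) [CStarAlgebra B]
      (π : FreeStar X →⋆ₐ[ℂ] B), (∀ a b, R a b → π a = π b) → ‖π a‖ ≤ K by
    intro a
    obtain ⟨K, hK⟩ := H a
    refine ⟨K, ?_⟩
    rintro r ⟨B, _, π, hπ, rfl⟩
    exact hK B π hπ
  intro a
  refine induction (p := fun a => ∃ K : ℝ, ∀ (B : Type) [CStarAlgebra B]
      (π : FreeStar X →⋆ₐ[ℂ] B), (∀ a b, R a b → π a = π b) → ‖π a‖ ≤ K) a ?_ ?_ ?_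
  · intro w
    induction w using FreeMonoid.inductionOn' with
    | one => exact ⟨1, fun B _ π _ => by rw [map_one, map_one]; exact norm_one_le_one B⟩
    | of_mul y w ih =>
      obtain ⟨K, hK⟩ := ih
      have hy : ∃ K' : ℝ, ∀ (B : Type) [CStarAlgebra B] (π : FreeStar X →⋆ₐ[ℂ] B),
          (∀ a b, R a b → π a = π b) → ‖π (word (FreeMonoid.of y))‖ ≤ K' := by
        rcases y with x | x
        · exact ⟨C x, fun B _ π hπ => h x B π hπ⟩
        · refine ⟨C x, fun B _ π hπ => ?_⟩
          have := h x B π hπ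
          rw [← norm_star, ← map_star, gen, star_word_of] at this
          exact this
      obtain ⟨K', hK'⟩ := hy
      refine ⟨K' * K, fun B _ π hπ => ?_⟩
      rw [map_mul, map_mul]
      exact (norm_mul_le _ _).trans (mul_le_mul (hK' B π hπ) (hK B π hπ) (norm_nonneg _)
        ((norm_nonneg _).trans (hK' B π hπ)))
  · rintro a b ⟨K, hK⟩ ⟨K', hK'⟩
    refine ⟨K + K', fun B _ π hπ => ?_⟩
    rw [map_add]
    exact (norm_add_le _ _).trans (add_le_add (hK B π hπ) (hK' B π hπ))
  · rintro c a ⟨K, hK⟩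
    refine ⟨‖c‖ * K, fun B _ π hπ => ?_⟩
    rw [map_smul, norm_smul]
    exact mul_le_mul_of_nonneg_left (hK B π hπ) (norm_nonneg _)

end FreeStar

/-! ### The maximal tensor product -/

theorem isBddRel_tensor (A B : Type) [CStarAlgebra A] [CStarAlgebra B] :
    IsBddRel (fun _ _ : A ⊗[ℂ] B => False) := by
  intro t
  suffices H : ∃ K : ℝ, ∀ (D : Type) [CStarAlgebra D] (π : A ⊗[ℂ] B →⋆ₐ[ℂ] D), ‖π t‖ ≤ K by
    obtain ⟨K, hK⟩ := H
    refine ⟨K, ?_⟩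
    rintro r ⟨D, _, π, -, rfl⟩
    exact hK D π
  induction t using TensorProduct.induction_on with
  | zero => exact ⟨0, fun D _ π => by simp⟩
  | add x y hx hy =>
    obtain ⟨K, hK⟩ := hx
    obtain ⟨K', hK'⟩ := hy
    refine ⟨K + K', fun D _ π => ?_⟩
    rw [map_add]
    exact (norm_add_le _ _).trans (add_le_add (hK D π) (hK' D π))
  | tmul a b =>
    refine ⟨‖a‖ * ‖b‖, fun D _ π => ?_⟩
    let f : A →⋆ₐ[ℂ] D :=
      { π.toAlgHom.comp Algebra.TensorProduct.includeLeft with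
        map_star' := fun a => by
          change π (star a ⊗ₜ 1) = star (π (a ⊗ₜ 1))
          rw [← map_star, TensorProduct.star_tmul, star_one] }
    let g : B →⋆ₐ[ℂ] D :=
      { π.toAlgHom.comp Algebra.TensorProduct.includeRight with
        map_star' := fun a => by
          change π (1 ⊗ₜ star a) = star (π (1 ⊗ₜ a))
          rw [← map_star, TensorProduct.star_tmul, star_one] }
    have hfg : π (a ⊗ₜ b) = f a * g b := by
      change _ = π (a ⊗ₜ 1) * π (1 ⊗ₜ b)
      rw [← map_mul, Algebra.TensorProduct.tmul_mul_tmul, mul_one, one_mul]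
    rw [hfg]
    exact (norm_mul_le _ _).trans (mul_le_mul (NonUnitalStarAlgHom.norm_apply_le f a)
      (NonUnitalStarAlgHom.norm_apply_le g b) (norm_nonneg _) (norm_nonneg _))

/-- The maximal tensor product of two unital C*-algebras: the completion of the algebraic tensor
product for its largest C*-seminorm. -/
def MaxTensor (A B : Type) [CStarAlgebra A] [CStarAlgebra B] : Type :=
  UnivCStar (fun _ _ : A ⊗[ℂ] B => False) (isBddRel_tensor A B)

namespace MaxTensor

variable {A B D : Type} [CStarAlgebra A] [CStarAlgebra B] [CStarAlgebra D]

instance : CStarAlgebra (MaxTensor A B) :=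
  inferInstanceAs (CStarAlgebra (UnivCStar (fun _ _ : A ⊗[ℂ] B => False) (isBddRel_tensor A B)))

/-- The canonical map from the algebraic tensor product. -/
def ofTensor : A ⊗[ℂ] B →⋆ₐ[ℂ] MaxTensor A B := UnivCStar.mk (isBddRel_tensor A B)

/-- The elementary tensors. -/
def tmul (a : A) (b : B) : MaxTensor A B := ofTensor (a ⊗ₜ[ℂ] b)

/-- Elementary tensors of the maximal tensor product. -/
infixl:100 " ⊠ " => FreeSpaces.MaxTensor.tmul

theorem tmul_mul_tmul (a a' : A) (b b' : B) : (a ⊠ b) * (a' ⊠ b') = (a * a') ⊠ (b * b') := by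
  rw [tmul, tmul, ← map_mul, Algebra.TensorProduct.tmul_mul_tmul, tmul]

theorem star_tmul (a : A) (b : B) : star (a ⊠ b) = star a ⊠ star b := by
  rw [tmul, ← map_star, TensorProduct.star_tmul, tmul]

theorem one_tmul_one : (1 : A) ⊠ (1 : B) = 1 := map_one (ofTensor (A := A) (B := B))

theorem zero_tmul (b : B) : (0 : A) ⊠ b = 0 := by
  rw [tmul, TensorProduct.zero_tmul, map_zero]

theorem sum_tmul {ι : Type} (s : Finset ι) (a : ι → A) (b : B) :
    (∑ i ∈ s, a i) ⊠ b = ∑ i ∈ s, a i ⊠ b := by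
  simp only [tmul, TensorProduct.sum_tmul, map_sum]

theorem tmul_sum {ι : Type} (s : Finset ι) (a : A) (b : ι → B) :
    a ⊠ (∑ i ∈ s, b i) = ∑ i ∈ s, a ⊠ b i := by
  simp only [tmul, TensorProduct.tmul_sum, map_sum]

/-- The inclusion `a ↦ a ⊗ 1`. -/
def inl : A →⋆ₐ[ℂ] MaxTensor A B where
  __ := (ofTensor (A := A) (B := B)).toAlgHom.comp Algebra.TensorProduct.includeLeft
  map_star' a := by
    change star a ⊠ (1 : B) = star (a ⊠ 1)
    rw [star_tmul, star_one]

/-- The inclusion `b ↦ 1 ⊗ b`. -/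
def inr : B →⋆ₐ[ℂ] MaxTensor A B where
  __ := (ofTensor (A := A) (B := B)).toAlgHom.comp Algebra.TensorProduct.includeRight
  map_star' b := by
    change (1 : A) ⊠ star b = star (1 ⊠ b)
    rw [star_tmul, star_one]

theorem inl_apply (a : A) : (inl a : MaxTensor A B) = a ⊠ 1 := rfl
theorem inr_apply (b : B) : (inr b : MaxTensor A B) = 1 ⊠ b := rfl

theorem inl_mul_inr (a : A) (b : B) : inl a * inr b = a ⊠ b := by
  rw [inl_apply, inr_apply, tmul_mul_tmul, mul_one, one_mul]

theorem commute_inl_inr (a : A) (b : B) : Commute (inl a : MaxTensor A B) (inr b) := by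
  rw [Commute, SemiconjBy, inl_apply, inr_apply, tmul_mul_tmul, tmul_mul_tmul]
  simp

/-- Universal property: two *-homomorphisms with commuting ranges induce
`a ⊗ b ↦ f a * g b`. -/
def lift (f : A →⋆ₐ[ℂ] D) (g : B →⋆ₐ[ℂ] D) (h : ∀ a b, Commute (f a) (g b)) :
    MaxTensor A B →⋆ₐ[ℂ] D :=
  UnivCStar.lift (isBddRel_tensor A B)
    { Algebra.TensorProduct.lift f.toAlgHom g.toAlgHom h with
      map_star' := fun t => by
        change Algebra.TensorProduct.lift f.toAlgHom g.toAlgHom h (star t) =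
          star (Algebra.TensorProduct.lift f.toAlgHom g.toAlgHom h t)
        induction t using TensorProduct.induction_on with
        | zero => simp
        | add x y hx hy => rw [star_add, map_add, map_add, hx, hy, star_add]
        | tmul a b =>
          rw [TensorProduct.star_tmul, Algebra.TensorProduct.lift_tmul,
            Algebra.TensorProduct.lift_tmul]
          change f (star a) * g (star b) = star (f a * g b)
          rw [star_mul, ← map_star, ← map_star, (h (star a) (star b)).eq] }
    (fun _ _ h => h.elim)

@[simp]
theorem lift_tmul (f : A →⋆ₐ[ℂ] D) (g : B →⋆ₐ[ℂ] D) (h : ∀ a b, Commute (f a) (g b))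
    (a : A) (b : B) : lift f g h (a ⊠ b) = f a * g b :=
  (UnivCStar.lift_mk _ _ _ _).trans
    (Algebra.TensorProduct.lift_tmul (S := ℂ) f.toAlgHom g.toAlgHom h a b)

theorem denseRange_ofTensor : DenseRange (ofTensor (A := A) (B := B)) :=
  UnivCStar.denseRange_mk (isBddRel_tensor A B)

/-- Commutation with all elementary tensors gives commutation with everything. -/
theorem commute_of_tmul {x : D} (f : MaxTensor A B →⋆ₐ[ℂ] D) (h : ∀ a b, Commute x (f (a ⊠ b)))
    (t : MaxTensor A B) : Commute x (f t) := by
  have hf : Continuous f := AddMonoidHomClass.continuous_of_bound f 1 fun t => by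
    rw [one_mul]; exact NonUnitalStarAlgHom.norm_apply_le f t
  refine denseRange_ofTensor.induction_on (p := fun t => Commute x (f t)) t ?_ fun t => ?_
  · exact isClosed_eq (continuous_const.mul hf) (hf.mul continuous_const)
  · induction t using TensorProduct.induction_on with
    | zero => simp
    | add u v hu hv => rw [map_add, map_add]; exact hu.add_right hv
    | tmul a b => exact h a b

/-- The tensor product `f ⊗ g` of two *-homomorphisms. -/
def map {A' B' : Type} [CStarAlgebra A'] [CStarAlgebra B'] (f : A →⋆ₐ[ℂ] A') (g : B →⋆ₐ[ℂ] B') :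
    MaxTensor A B →⋆ₐ[ℂ] MaxTensor A' B' :=
  lift (inl.comp f) (inr.comp g) fun a b => by
    rw [StarAlgHom.comp_apply, StarAlgHom.comp_apply]; exact commute_inl_inr (f a) (g b)

@[simp]
theorem map_tmul {A' B' : Type} [CStarAlgebra A'] [CStarAlgebra B'] (f : A →⋆ₐ[ℂ] A')
    (g : B →⋆ₐ[ℂ] B') (a : A) (b : B) : map f g (a ⊠ b) = f a ⊠ g b :=
  (lift_tmul _ _ _ a b).trans (inl_mul_inr (f a) (g b))

/-- The associativity map `(a ⊗ b) ⊗ d ↦ a ⊗ (b ⊗ d)`. -/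
def assoc : MaxTensor (MaxTensor A B) D →⋆ₐ[ℂ] MaxTensor A (MaxTensor B D) :=
  lift
    (lift inl (inr.comp inl) fun a b => by
      rw [StarAlgHom.comp_apply]; exact commute_inl_inr a (inl b))
    (inr.comp inr) fun t d =>
      (commute_of_tmul _ (fun a b => by
        rw [lift_tmul, StarAlgHom.comp_apply, StarAlgHom.comp_apply]
        exact (Commute.mul_left (commute_inl_inr a (inr d))
          ((commute_inl_inr b d).map (inr (A := A)))).symm) t).symm

@[simp]
theorem assoc_tmul (a : A) (b : B) (d : D) : assoc ((a ⊠ b) ⊠ d) = a ⊠ (b ⊠ d) := by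
  rw [assoc, lift_tmul, lift_tmul, StarAlgHom.comp_apply, StarAlgHom.comp_apply, mul_assoc,
    ← map_mul, inl_mul_inr, inl_mul_inr]

/-- The flip of the two middle factors, `(a ⊗ a') ⊗ (b ⊗ b') ↦ (a ⊗ b) ⊗ (a' ⊗ b')`. -/
def flipMid {A' B' : Type} [CStarAlgebra A'] [CStarAlgebra B'] :
    MaxTensor (MaxTensor A A') (MaxTensor B B') →⋆ₐ[ℂ]
      MaxTensor (MaxTensor A B) (MaxTensor A' B') :=
  lift (map inl inl) (map inr inr) fun t t' =>
    commute_of_tmul _ (fun b b' => (commute_of_tmul _ (fun a a' => by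
      rw [map_tmul, map_tmul, Commute, SemiconjBy, tmul_mul_tmul, tmul_mul_tmul,
        (commute_inl_inr a b).eq, (commute_inl_inr a' b').eq]) t).symm) t'

@[simp]
theorem flipMid_tmul {A' B' : Type} [CStarAlgebra A'] [CStarAlgebra B'] (a : A) (a' : A') (b : B)
    (b' : B') : flipMid ((a ⊠ a') ⊠ (b ⊠ b')) = (a ⊠ b) ⊠ (a' ⊠ b') := by
  rw [flipMid, lift_tmul, map_tmul, map_tmul, tmul_mul_tmul, inl_mul_inr, inl_mul_inr]

/-- The slice map `φ ⊗ id`, for a unital *-homomorphism `φ` to the complex numbers. -/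
def slice (φ : A →⋆ₐ[ℂ] ℂ) : MaxTensor A B →⋆ₐ[ℂ] B :=
  lift ((StarAlgHom.ofId ℂ B).comp φ) (StarAlgHom.id ℂ B) fun a b => by
    rw [StarAlgHom.comp_apply]; exact Algebra.commutes (φ a) b

@[simp]
theorem slice_tmul (φ : A →⋆ₐ[ℂ] ℂ) (a : A) (b : B) : slice φ (a ⊠ b) = φ a • b :=
  (lift_tmul _ _ _ a b).trans (Algebra.smul_def (φ a) b).symm

/-- Orthogonality of the first legs removes the cross terms in a product of sums. -/
theorem sum_mul_sum {ι : Type} [Fintype ι] (a a' : ι → A) (b b' : ι → B)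
    (h : ∀ k l, k ≠ l → a k * a' l = 0) :
    (∑ k, a k ⊠ b k) * (∑ k, a' k ⊠ b' k) = ∑ k, (a k * a' k) ⊠ (b k * b' k) := by
  rw [Finset.sum_mul_sum]
  refine Finset.sum_congr rfl fun k _ => ?_
  rw [Finset.sum_eq_single k, tmul_mul_tmul]
  · intro l _ hl
    rw [tmul_mul_tmul, h k l (Ne.symm hl), zero_tmul]
  · simp

end MaxTensor
end FreeSpaces

namespace FreeSpaces

/-! ### The noncommutative spaces -/

/-- The matrix of standard generators of the free *-algebra on `M × N` variables. -/
def genMatrix (M N : ℕ) : Matrix (Fin M) (Fin N) (FreeStar (Fin M × Fin N)) :=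
  Matrix.of fun i j => FreeStar.gen (i, j)

/-- The relations saying that the square matrix `p` over a *-algebra is a projection of trace `L`,
that is, `p² = p = p*` and `∑ i, p i i = L`. -/
inductive ProjOfTraceRel {A : Type} [Ring A] [StarRing A] {M : ℕ} (L : ℕ)
    (p : Matrix (Fin M) (Fin M) A) : A → A → Prop
  | idem (i j : Fin M) : ProjOfTraceRel L p ((p * p) i j) (p i j)
  | selfAdjoint (i j : Fin M) : ProjOfTraceRel L p (p.conjTranspose i j) (p i j)
  | trace : ProjOfTraceRel L p p.trace (L : A)

/-- The defining relations of the free space of partial isometries: with `ū` the matrix of adjoints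
of the entries of `u`, both `u u*` and `ū uᵗ` are projections of trace `L`. -/
def URel (L M N : ℕ) (x y : FreeStar (Fin M × Fin N)) : Prop :=
  ProjOfTraceRel L (genMatrix M N * (genMatrix M N).conjTranspose) x y ∨
  ProjOfTraceRel L ((genMatrix M N).map star * (genMatrix M N).transpose) x y

/-- The relations `u_ij u_ij* = u_ij* u_ij = p_ij`, with `p_ij` projections, and `u_ij ^ s = p_ij`.
The last relation is only imposed when `s` is finite (and positive, which is always the case
below). -/
inductive HRel {A : Type} [Ring A] [StarRing A] {M N : ℕ} (s : ℕ∞)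
    (u : Matrix (Fin M) (Fin N) A) : A → A → Prop
  | normal (i : Fin M) (j : Fin N) : HRel s u (star (u i j) * u i j) (u i j * star (u i j))
  | idem (i : Fin M) (j : Fin N) :
      HRel s u ((u i j * star (u i j)) * (u i j * star (u i j))) (u i j * star (u i j))
  | selfAdjoint (i : Fin M) (j : Fin N) :
      HRel s u (star (u i j * star (u i j))) (u i j * star (u i j))
  | pow (i : Fin M) (j : Fin N) (k : ℕ) (hk : 0 < k) (hs : s = k) :
      HRel s u (u i j ^ k) (u i j * star (u i j))

/-- The defining relations of the free complex reflection groups: the relations `HRel`, and the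
projections `p_ij = u_ij u_ij*` sum up to `1` on each row and column. -/
inductive HGroupRel {A : Type} [Ring A] [StarRing A] {N : ℕ} (s : ℕ∞)
    (u : Matrix (Fin N) (Fin N) A) : A → A → Prop
  | entry {x y : A} (h : HRel s u x y) : HGroupRel s u x y
  | row (i : Fin N) : HGroupRel s u (∑ j, u i j * star (u i j)) 1
  | col (j : Fin N) : HGroupRel s u (∑ i, u i j * star (u i j)) 1

theorem isBddRel_URel (L M N : ℕ) : IsBddRel (URel L M N) := by
  refine FreeStar.isBddRel (fun _ => √L) fun x B _ π hπ => ?_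
  obtain ⟨i, j⟩ := x
  let _ := CStarAlgebra.spectralOrder B
  let _ := CStarAlgebra.spectralOrderedRing B
  have h := hπ _ _ (Or.inl (ProjOfTraceRel.trace (L := L)))
  simp only [Matrix.trace, Matrix.diag, Matrix.mul_apply, Matrix.conjTranspose_apply, map_sum,
    map_mul, map_star, map_natCast, genMatrix, Matrix.of_apply] at h
  have hle : π (FreeStar.gen (i, j)) * star (π (FreeStar.gen (i, j))) ≤ (L : B) := by
    rw [← h]
    refine le_trans ?_ (Finset.single_le_sum
      (f := fun i => ∑ j, π (FreeStar.gen (i, j)) * star (π (FreeStar.gen (i, j))))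
      (fun i _ => Finset.sum_nonneg fun j _ => mul_star_self_nonneg _) (Finset.mem_univ i))
    exact Finset.single_le_sum (f := fun j => π (FreeStar.gen (i, j)) * star (π (FreeStar.gen (i, j))))
      (fun j _ => mul_star_self_nonneg _) (Finset.mem_univ j)
  have hn := CStarAlgebra.norm_le_norm_of_nonneg_of_le (mul_star_self_nonneg _) hle
  rw [CStarRing.norm_self_mul_star] at hn
  refine Real.le_sqrt_of_sq_le ?_
  rw [sq]
  refine hn.trans ?_
  have : (L : B) = (L : ℝ) • (1 : B) := by simp [Nat.cast_smul_eq_nsmul]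
  rw [this, norm_smul]
  calc ‖(L : ℝ)‖ * ‖(1 : B)‖ ≤ ‖(L : ℝ)‖ * 1 := by gcongr; exact norm_one_le_one B
    _ = L := by simp

theorem norm_le_one_of_proj {B : Type} [CStarAlgebra B] {u : B}
    (h : (u * star u) * (u * star u) = u * star u) : ‖u‖ ≤ 1 := by
  have h1 : ‖u * star u‖ ≤ 1 := by
    have : ‖u * star u‖ * ‖u * star u‖ = ‖u * star u‖ := by
      have h2 := CStarRing.norm_self_mul_star (x := u * star u)
      rw [star_mul, star_star, h] at h2
      exact h2.symm
    nlinarith [norm_nonneg (u * star u)]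
  rw [CStarRing.norm_self_mul_star] at h1
  nlinarith [norm_nonneg u]

theorem isBddRel_HGroupRel (N : ℕ) (s : ℕ∞) : IsBddRel (HGroupRel s (genMatrix N N)) := by
  refine FreeStar.isBddRel (fun _ => 1) fun x B _ π hπ => ?_
  obtain ⟨i, j⟩ := x
  have h := hπ _ _ (.entry (.idem i j))
  simp only [map_mul, map_star] at h
  exact norm_le_one_of_proj h

theorem isBddRel_of_cstar {A : Type} [CStarAlgebra A] (R : A → A → Prop) : IsBddRel R := by
  intro a
  refine ⟨‖a‖, ?_⟩
  rintro r ⟨B, _, π, -, rfl⟩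
  exact NonUnitalStarAlgHom.norm_apply_le π a

/-- The C*-algebra `C(U_{MN}^{L+})`. -/
def CU (L M N : ℕ) : Type := UnivCStar (URel L M N) (isBddRel_URel L M N)

instance (L M N : ℕ) : CStarAlgebra (CU L M N) :=
  inferInstanceAs (CStarAlgebra (UnivCStar (URel L M N) (isBddRel_URel L M N)))

/-- The matrix of standard coordinates of `U_{MN}^{L+}`. -/
def CU.coord (L M N : ℕ) : Matrix (Fin M) (Fin N) (CU L M N) :=
  (genMatrix M N).map (UnivCStar.mk (isBddRel_URel L M N))

/-- The C*-algebra `C(H_{MN}^{sL+})`, the quotient of `C(U_{MN}^{L+})` by the relations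
`u_ij u_ij* = u_ij* u_ij = p_ij = projections`, `u_ij ^ s = p_ij`. -/
def CHSpace (s : ℕ∞) (L M N : ℕ) : Type :=
  UnivCStar (HRel s (CU.coord L M N)) (isBddRel_of_cstar _)

instance (s : ℕ∞) (L M N : ℕ) : CStarAlgebra (CHSpace s L M N) :=
  inferInstanceAs (CStarAlgebra (UnivCStar (HRel s (CU.coord L M N)) (isBddRel_of_cstar _)))

/-- The quotient map `C(U_{MN}^{L+}) → C(H_{MN}^{sL+})`. -/
def CHSpace.ofCU (s : ℕ∞) (L M N : ℕ) : CU L M N →⋆ₐ[ℂ] CHSpace s L M N :=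
  UnivCStar.mk (R := HRel s (CU.coord L M N)) (isBddRel_of_cstar _)

/-- The matrix of standard coordinates of `H_{MN}^{sL+}`. -/
def CHSpace.coord (s : ℕ∞) (L M N : ℕ) : Matrix (Fin M) (Fin N) (CHSpace s L M N) :=
  (CU.coord L M N).map (CHSpace.ofCU s L M N)

/-- The C*-algebra `C(H_N^{s+})` of the free complex reflection group. -/
def CH (s : ℕ∞) (N : ℕ) : Type :=
  UnivCStar (HGroupRel s (genMatrix N N)) (isBddRel_HGroupRel N s)

instance (s : ℕ∞) (N : ℕ) : CStarAlgebra (CH s N) :=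
  inferInstanceAs (CStarAlgebra (UnivCStar (HGroupRel s (genMatrix N N)) (isBddRel_HGroupRel N s)))

namespace CH

/-- The matrix of standard coordinates of `H_N^{s+}`. -/
def coord (s : ℕ∞) (N : ℕ) : Matrix (Fin N) (Fin N) (CH s N) :=
  (genMatrix N N).map (UnivCStar.mk (isBddRel_HGroupRel N s))

/-- The square matrix `v` over a *-algebra `B` satisfies the defining relations of `H_N^{s+}`. -/
def IsHGroup {B : Type} [Ring B] [StarRing B] {N : ℕ} (s : ℕ∞) (v : Matrix (Fin N) (Fin N) B) :
    Prop := ∀ x y, HGroupRel s v x y → x = y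

theorem isHGroup_of_hom {s : ℕ∞} {N : ℕ} {A B : Type} [Ring A] [StarRing A] [Algebra ℂ A]
    [Ring B] [StarRing B] [Algebra ℂ B] {u : Matrix (Fin N) (Fin N) A} (π : A →⋆ₐ[ℂ] B)
    (h : ∀ x y, HGroupRel s u x y → π x = π y) : IsHGroup s (u.map π) := by
  rintro x y (⟨⟨i, j⟩ | ⟨i, j⟩ | ⟨i, j⟩ | ⟨i, j, k, hk, hs⟩⟩ | i | j)
  · simpa [map_star] using h _ _ (.entry (.normal i j))
  · simpa [map_star] using h _ _ (.entry (.idem i j))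
  · simp
  · simpa [map_star] using h _ _ (.entry (.pow i j k hk hs))
  · simpa [map_star] using h _ _ (.row i)
  · simpa [map_star] using h _ _ (.col j)

theorem hom_of_isHGroup {s : ℕ∞} {N : ℕ} {A B : Type} [Ring A] [StarRing A] [Algebra ℂ A]
    [Ring B] [StarRing B] [Algebra ℂ B] {u : Matrix (Fin N) (Fin N) A} (π : A →⋆ₐ[ℂ] B)
    (h : IsHGroup s (u.map π)) : ∀ x y, HGroupRel s u x y → π x = π y := by
  rintro x y (⟨⟨i, j⟩ | ⟨i, j⟩ | ⟨i, j⟩ | ⟨i, j, k, hk, hs⟩⟩ | i | j)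
  · simpa [map_star] using h _ _ (.entry (.normal i j))
  · simpa [map_star] using h _ _ (.entry (.idem i j))
  · simp [map_star]
  · simpa [map_star] using h _ _ (.entry (.pow i j k hk hs))
  · simpa [map_star] using h _ _ (.row i)
  · simpa [map_star] using h _ _ (.col j)

theorem isHGroup_coord (s : ℕ∞) (N : ℕ) : IsHGroup s (coord s N) :=
  isHGroup_of_hom _ fun _ _ h => UnivCStar.mk_eq_of_rel _ h

/-- Universal property of `C(H_N^{s+})`. -/
def lift {s : ℕ∞} {N : ℕ} {B : Type} [CStarAlgebra B] (v : Matrix (Fin N) (Fin N) B)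
    (hv : IsHGroup s v) : CH s N →⋆ₐ[ℂ] B :=
  UnivCStar.lift (isBddRel_HGroupRel N s) (FreeStar.lift fun x => v x.1 x.2)
    (hom_of_isHGroup _ (by
      have : (genMatrix N N).map (FreeStar.lift fun x => v x.1 x.2) = v := by
        ext i j; simp [genMatrix]
      rw [this]; exact hv))

@[simp]
theorem lift_coord {s : ℕ∞} {N : ℕ} {B : Type} [CStarAlgebra B] (v : Matrix (Fin N) (Fin N) B)
    (hv : IsHGroup s v) (i j : Fin N) : lift v hv (coord s N i j) = v i j :=
  (UnivCStar.lift_mk _ _ _ _).trans (FreeStar.lift_gen _ _)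

/-- Projections in a C*-algebra that sum up to `1` are pairwise orthogonal. -/
theorem proj_orthogonal {B : Type} [CStarAlgebra B] {ι : Type} [Fintype ι] (p : ι → B)
    (hi : ∀ k, p k * p k = p k) (hs : ∀ k, star (p k) = p k) (h1 : ∑ k, p k = 1) {k l : ι}
    (hkl : k ≠ l) : p k * p l = 0 := by
  classical
  let _ := CStarAlgebra.spectralOrder B
  let _ := CStarAlgebra.spectralOrderedRing B
  have hnn : ∀ m, 0 ≤ p k * p m * p k := fun m => by
    have : p k * p m * p k = star (p m * p k) * (p m * p k) := by
      rw [star_mul, hs, hs, mul_assoc (p k) (p m) (p m * p k), ← mul_assoc (p m) (p m), hi, mul_assoc]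
    rw [this]; exact star_mul_self_nonneg _
  have hsum : ∑ m, p k * p m * p k = p k := by
    rw [← Finset.sum_mul, ← Finset.mul_sum, h1, mul_one, hi]
  rw [← Finset.add_sum_erase _ _ (Finset.mem_univ k), hi, hi, add_eq_left] at hsum
  have h0 := (Finset.sum_eq_zero_iff_of_nonneg fun m _ => hnn m).1 hsum l
    (Finset.mem_erase.2 ⟨hkl.symm, Finset.mem_univ l⟩)
  have h2 : star (p l * p k) * (p l * p k) = 0 := by
    rw [← h0, star_mul, hs, hs, mul_assoc (p k) (p l) (p l * p k), ← mul_assoc (p l) (p l), hi,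
      mul_assoc]
  have h3 := (CStarRing.star_mul_self_eq_zero_iff _).1 h2
  have h4 := congrArg star h3
  rwa [star_mul, hs, hs, star_zero] at h4

theorem IsHGroup.normal {s : ℕ∞} {N : ℕ} {B : Type} [CStarAlgebra B] {v : Matrix (Fin N) (Fin N) B}
    (hv : IsHGroup s v) (i j : Fin N) : star (v i j) * v i j = v i j * star (v i j) :=
  hv _ _ (.entry (.normal i j))

theorem IsHGroup.idem {s : ℕ∞} {N : ℕ} {B : Type} [CStarAlgebra B] {v : Matrix (Fin N) (Fin N) B}
    (hv : IsHGroup s v) (i j : Fin N) :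
    (v i j * star (v i j)) * (v i j * star (v i j)) = v i j * star (v i j) :=
  hv _ _ (.entry (.idem i j))

theorem mul_star_mul_self {B : Type} [CStarAlgebra B] {u : B}
    (h : (u * star u) * (u * star u) = u * star u) : (u * star u) * u = u := by
  have : (u * star u * u - u) * star (u * star u * u - u) = 0 := by
    have e : star (u * star u * u - u) = star u * (u * star u) - star u := by
      simp [mul_assoc]
    have e2 : (u * star u * u - u) * (star u * (u * star u) - star u) =
        (u * star u) * (u * star u) * (u * star u) - (u * star u) * (u * star u)
          - (u * star u) * (u * star u) + u * star u := by noncomm_ring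
    rw [e, e2, h, h]; abel
  exact sub_eq_zero.1 ((CStarRing.mul_star_self_eq_zero_iff _).1 this)

/-- Two normal elements with orthogonal range projections are orthogonal. -/
theorem mul_eq_zero_of_proj {B : Type} [CStarAlgebra B] {x y : B}
    (hx : (x * star x) * (x * star x) = x * star x) (hxn : star x * x = x * star x)
    (hy : (y * star y) * (y * star y) = y * star y) (hyn : star y * y = y * star y)
    (h : (x * star x) * (y * star y) = 0) : x * y = 0 ∧ x * star y = 0 ∧ star x * y = 0 := by
  have x1 : x * (x * star x) = x := by rw [← hxn, ← mul_assoc, mul_star_mul_self hx]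
  have x2 : star x * (x * star x) = star x := by
    have := congrArg star (mul_star_mul_self hx)
    rwa [star_mul, star_mul, star_star] at this
  have y1 : (y * star y) * y = y := mul_star_mul_self hy
  have y2 : (y * star y) * star y = star y := by
    have := congrArg star (show y * (y * star y) = y by
      rw [← hyn, ← mul_assoc, mul_star_mul_self hy])
    rwa [star_mul, star_mul, star_star] at this
  refine ⟨?_, ?_, ?_⟩
  · rw [← x1, ← y1, mul_assoc x, ← mul_assoc (x * star x) (y * star y), h, zero_mul, mul_zero]
  · rw [← x1, ← y2, mul_assoc x, ← mul_assoc (x * star x) (y * star y), h, zero_mul, mul_zero]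
  · rw [← x2, ← y1, mul_assoc (star x), ← mul_assoc (x * star x) (y * star y), h, zero_mul,
      mul_zero]

theorem IsHGroup.row_orthogonal {s : ℕ∞} {N : ℕ} {B : Type} [CStarAlgebra B]
    {v : Matrix (Fin N) (Fin N) B} (hv : IsHGroup s v) (i k l : Fin N) (hkl : k ≠ l) :
    v i k * v i l = 0 ∧ v i k * star (v i l) = 0 ∧ star (v i k) * v i l = 0 :=
  mul_eq_zero_of_proj (hv.idem i k) (hv.normal i k) (hv.idem i l) (hv.normal i l)
    (proj_orthogonal (fun j => v i j * star (v i j)) (fun j => hv.idem i j)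
      (fun j => by simp) (hv _ _ (.row i)) hkl)

/-- The matrix `∑ k, u_ik ⊗ u_kj`. -/
def comulMatrix (s : ℕ∞) (N : ℕ) : Matrix (Fin N) (Fin N) (MaxTensor (CH s N) (CH s N)) :=
  Matrix.of fun i j => ∑ k, coord s N i k ⊠ coord s N k j

theorem comulMatrix_apply (s : ℕ∞) (N : ℕ) (i j : Fin N) :
    comulMatrix s N i j = ∑ k, coord s N i k ⊠ coord s N k j := rfl

theorem star_comulMatrix (s : ℕ∞) (N : ℕ) (i j : Fin N) :
    star (comulMatrix s N i j) = ∑ k, star (coord s N i k) ⊠ star (coord s N k j) := by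
  simp only [comulMatrix_apply, star_sum, MaxTensor.star_tmul]

theorem comulMatrix_mul_star (s : ℕ∞) (N : ℕ) (i j : Fin N) :
    comulMatrix s N i j * star (comulMatrix s N i j) =
      ∑ k, (coord s N i k * star (coord s N i k)) ⊠ (coord s N k j * star (coord s N k j)) := by
  rw [star_comulMatrix, comulMatrix_apply]
  exact MaxTensor.sum_mul_sum _ _ _ _ fun k l h =>
    ((isHGroup_coord s N).row_orthogonal i k l h).2.1

theorem comulMatrix_pow (s : ℕ∞) (N : ℕ) (i j : Fin N) (n : ℕ) :
    comulMatrix s N i j ^ (n + 1) =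
      ∑ k, (coord s N i k ^ (n + 1)) ⊠ (coord s N k j ^ (n + 1)) := by
  induction n with
  | zero => simp [comulMatrix_apply]
  | succ n ih =>
    rw [pow_succ, ih, comulMatrix_apply]
    refine (MaxTensor.sum_mul_sum _ _ _ _ fun k l h => ?_).trans ?_
    · rw [pow_succ, mul_assoc, ((isHGroup_coord s N).row_orthogonal i k l h).1, mul_zero]
    · simp only [pow_succ]

theorem isHGroup_comulMatrix (s : ℕ∞) (N : ℕ) : IsHGroup s (comulMatrix s N) := by
  have hu := isHGroup_coord s N
  rintro x y (⟨⟨i, j⟩ | ⟨i, j⟩ | ⟨i, j⟩ | ⟨i, j, k, hk, hs⟩⟩ | i | j)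
  · rw [comulMatrix_mul_star, star_comulMatrix, comulMatrix_apply]
    refine (MaxTensor.sum_mul_sum _ _ _ _ fun k l h => (hu.row_orthogonal i k l h).2.2).trans ?_
    simp only [hu.normal]
  · rw [comulMatrix_mul_star]
    refine (MaxTensor.sum_mul_sum _ _ _ _ fun k l h => ?_).trans ?_
    · rw [mul_assoc, ← mul_assoc (star _), (hu.row_orthogonal i k l h).2.2, zero_mul, mul_zero]
    · simp only [hu.idem]
  · rw [star_mul, star_star]
  · obtain ⟨n, rfl⟩ : ∃ n, k = n + 1 := ⟨k - 1, by omega⟩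
    rw [comulMatrix_mul_star, comulMatrix_pow]
    exact Finset.sum_congr rfl fun l _ => by
      rw [hu _ _ (.entry (.pow i l _ hk hs)), hu _ _ (.entry (.pow l j _ hk hs))]
  · simp only [comulMatrix_mul_star]
    rw [Finset.sum_comm]
    simp only [← MaxTensor.tmul_sum, hu _ _ (.row _), ← MaxTensor.sum_tmul,
      MaxTensor.one_tmul_one]
  · simp only [comulMatrix_mul_star]
    rw [Finset.sum_comm]
    simp only [← MaxTensor.sum_tmul, hu _ _ (.col _), ← MaxTensor.tmul_sum,
      MaxTensor.one_tmul_one]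

/-- The comultiplication of `C(H_N^{s+})`, given by `Δ(u_ij) = ∑ k, u_ik ⊗ u_kj`. -/
def comul (s : ℕ∞) (N : ℕ) : CH s N →⋆ₐ[ℂ] MaxTensor (CH s N) (CH s N) :=
  lift (comulMatrix s N) (isHGroup_comulMatrix s N)

theorem comul_coord (s : ℕ∞) (N : ℕ) (i j : Fin N) :
    comul s N (coord s N i j) = ∑ k, coord s N i k ⊠ coord s N k j :=
  lift_coord _ _ i j

theorem isHGroup_one (s : ℕ∞) (N : ℕ) : IsHGroup s (1 : Matrix (Fin N) (Fin N) ℂ) := by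
  rintro x y (⟨⟨i, j⟩ | ⟨i, j⟩ | ⟨i, j⟩ | ⟨i, j, k, hk, hs⟩⟩ | i | j)
  · exact mul_comm _ _
  · by_cases h : i = j <;> simp [Matrix.one_apply, h]
  · rw [star_mul, star_star]
  · by_cases h : i = j
    · subst h; simp
    · simp [h, hk.ne']
  · simp [Matrix.one_apply]
  · simp [Matrix.one_apply]

/-- The counit of `C(H_N^{s+})`, given by `ε(u_ij) = δ_ij`. -/
def counit (s : ℕ∞) (N : ℕ) : CH s N →⋆ₐ[ℂ] ℂ :=
  lift (1 : Matrix (Fin N) (Fin N) ℂ) (isHGroup_one s N)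

end CH

/-! ### The product quantum group and its actions -/

/-- The C*-algebra `C(H_M^{s+} × H_N^{s+})`. -/
abbrev CHProd (s : ℕ∞) (M N : ℕ) : Type := MaxTensor (CH s M) (CH s N)

/-- The comultiplication of the product quantum group `H_M^{s+} × H_N^{s+}`, which maps `a ⊗ b` to
`Δ(a) ⊗ Δ(b)` with the two middle factors flipped. -/
def CHProd.comul (s : ℕ∞) (M N : ℕ) : CHProd s M N →⋆ₐ[ℂ] MaxTensor (CHProd s M N) (CHProd s M N) :=
  MaxTensor.flipMid.comp (MaxTensor.map (CH.comul s M) (CH.comul s N))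

/-- The counit of the product quantum group `H_M^{s+} × H_N^{s+}`. -/
def CHProd.counit (s : ℕ∞) (M N : ℕ) : CHProd s M N →⋆ₐ[ℂ] ℂ :=
  MaxTensor.lift (CH.counit s M) (CH.counit s N) fun _ _ => mul_comm _ _

/-- `Φ : C(X) → C(G) ⊗ C(X)` is a coaction, for a C*-algebra `G` with comultiplication `Δ` and
counit `ε`: it is coassociative and counital, and satisfies the density condition. -/
structure IsCoaction {G X : Type} [CStarAlgebra G] [CStarAlgebra X]
    (Δ : G →⋆ₐ[ℂ] MaxTensor G G) (ε : G →⋆ₐ[ℂ] ℂ) (Φ : X →⋆ₐ[ℂ] MaxTensor G X) : Prop where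
  coassoc : (MaxTensor.assoc.comp (MaxTensor.map Δ (StarAlgHom.id ℂ X))).comp Φ =
    (MaxTensor.map (StarAlgHom.id ℂ G) Φ).comp Φ
  counit : (MaxTensor.slice ε).comp Φ = StarAlgHom.id ℂ X
  dense : Dense (Submodule.span ℂ {z : MaxTensor G X | ∃ (x : X) (g : G), z = Φ x * (g ⊠ 1)} :
    Set (MaxTensor G X))

end FreeSpaces

end

noncomputable section

namespace FreeSpaces

/-! In matrix form the proposed action sends `u` to `v = a u b*`, where `a`, `u`, `b` live in three
commuting tensor legs (`actionMatrix_eq`). By the universal property `CHSpace.lift`, `Φ` exists once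
`v` satisfies the relations of `X`.

The row relations make the entries in each row of `a` and `b` pairwise orthogonal. Together with the
column sums this gives `a* a = 1` and `aᵗ ā = 1`, and likewise for `b`. Hence `v v* = a (u u*) a*`,
because `b* b` cancels, and conjugation by `a` preserves projections. It also preserves the trace:
the entries of `a` commute with those of `u u*`, so `aᵗ ā = 1` replaces the missing cyclicity
(`IsProjOfTrace.conj`). The matrix `v̄ vᵗ` is handled in the same way with `ā` in place of `a`. The
relations on single entries hold because each entry of `v` is a sum of pairwise orthogonal terms,
each satisfying them (`IsHEntry.sum`, `isHEntry_actionMatrix`).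

Coassociativity and counitality are checked on generators (`hom_ext`). For density, the column
relations recover `1 ⊗ u_kl` as a sum of elements `Φ(u_ij)(g ⊗ 1)` (`sum_mul_tmul_one`). The `x`
with `1 ⊗ x` in the span of such products form a subalgebra, which contains the coordinates and
their adjoints, hence is dense in `C(X)`.

Finally, `π` is the orbit map of a classical point: the partial identity matrix of rank `L`
satisfies the relations of `X` over `ℂ`, so it defines a character `φ`, and `π = (id ⊗ φ) Φ`.
Compatibility is then a sliced form of coassociativity. -/

theorem continuous_starAlgHom {A B : Type} [CStarAlgebra A] [CStarAlgebra B] (f : A →⋆ₐ[ℂ] B) :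
    Continuous f :=
  AddMonoidHomClass.continuous_of_bound f 1 fun t => by
    rw [one_mul]; exact NonUnitalStarAlgHom.norm_apply_le f t

namespace FreeStar

/-- A subalgebra of the free *-algebra containing the generators and their adjoints is everything. -/
theorem mem_of_gen {X : Type} (S : Subalgebra ℂ (FreeStar X)) (h : ∀ x, gen x ∈ S)
    (h' : ∀ x, star (gen x) ∈ S) (a : FreeStar X) : a ∈ S := by
  refine induction (p := fun a => a ∈ S) a (fun w => ?_) (fun a b => S.add_mem)
    (fun c a ha => S.smul_mem ha c)
  induction w using FreeMonoid.inductionOn' with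
  | one => rw [map_one]; exact S.one_mem
  | of_mul y w ih =>
    rw [map_mul]
    refine S.mul_mem ?_ ih
    rcases y with x | x
    · exact h x
    · have := h' x
      rwa [gen, star_word_of] at this

end FreeStar

/-! ### Entries of the generating matrices -/

/-- The relations imposed by `HRel s` on each entry of the matrix. -/
structure IsHEntry {B : Type} [Ring B] [StarRing B] (s : ℕ∞) (x : B) : Prop where
  normal : star x * x = x * star x
  idem : (x * star x) * (x * star x) = x * star x
  pow : ∀ k : ℕ, 0 < k → s = k → x ^ k = x * star x

section Ring

variable {B : Type} [Ring B] [StarRing B] {s : ℕ∞}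

theorem isHEntry_of_HRel {M N : ℕ} {v : Matrix (Fin M) (Fin N) B}
    (h : ∀ x y, HRel s v x y → x = y) (i : Fin M) (j : Fin N) : IsHEntry s (v i j) :=
  ⟨h _ _ (.normal i j), h _ _ (.idem i j), fun k hk hs => h _ _ (.pow i j k hk hs)⟩

theorem isHEntry_zero : IsHEntry s (0 : B) :=
  ⟨by simp, by simp, fun k hk _ => by simp [hk.ne']⟩

theorem isHEntry_one : IsHEntry s (1 : B) :=
  ⟨by simp, by simp, fun k _ _ => by simp⟩

theorem IsHEntry.star {x : B} (h : IsHEntry s x) : IsHEntry s (star x) where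
  normal := by rw [star_star, h.normal]
  idem := by rw [star_star, h.normal, h.idem]
  pow k hk hs := by rw [← star_pow, h.pow k hk hs, star_mul, star_star, h.normal]

/-- A sum of pairwise orthogonal elements satisfies the relations of its summands. -/
theorem IsHEntry.sum {ι : Type} [Fintype ι] {x : ι → B} (h : ∀ t, IsHEntry s (x t))
    (h1 : ∀ t t', t ≠ t' → x t * x t' = 0) (h2 : ∀ t t', t ≠ t' → x t * Star.star (x t') = 0)
    (h3 : ∀ t t', t ≠ t' → Star.star (x t) * x t' = 0) : IsHEntry s (∑ t, x t) := by
  have key : ∀ y z : ι → B, (∀ t t', t ≠ t' → y t * z t' = 0) →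
      (∑ t, y t) * (∑ t, z t) = ∑ t, y t * z t := fun y z hyz => by
    rw [Finset.sum_mul_sum]
    refine Finset.sum_congr rfl fun t _ => Finset.sum_eq_single t (fun t' _ ht' => ?_) (by simp)
    exact hyz t t' ht'.symm
  have e : (∑ t, x t) * Star.star (∑ t, x t) = ∑ t, x t * Star.star (x t) := by
    rw [star_sum]; exact key _ _ h2
  refine ⟨?_, ?_, fun k hk hs => ?_⟩
  · rw [e, star_sum, key _ _ h3]
    exact Finset.sum_congr rfl fun t _ => (h t).normal
  · rw [e, key _ _ fun t t' ht => ?_]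
    · exact Finset.sum_congr rfl fun t _ => (h t).idem
    -- Range projections of distinct summands are orthogonal because the inner factor of `x x* x'
    -- x'*` is `x* x' = 0`.
    · rw [mul_assoc, ← mul_assoc (Star.star _), h3 t t' ht, zero_mul, mul_zero]
  · have hp : ∀ n, (∑ t, x t) ^ (n + 1) = ∑ t, x t ^ (n + 1) := fun n => by
      induction n with
      | zero => simp
      | succ n ih =>
        rw [pow_succ, ih, key _ _ fun t t' ht => ?_]
        · simp only [pow_succ]
        · rw [pow_succ, mul_assoc, h1 t t' ht, mul_zero]
    -- Positivity of the exponent matters: powers distribute over an orthogonal sum only from the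
    -- first power on, the zeroth power being `1`.
    obtain ⟨n, rfl⟩ : ∃ n, k = n + 1 := ⟨k - 1, by omega⟩
    rw [e, hp]
    exact Finset.sum_congr rfl fun t _ => (h t).pow _ hk hs

end Ring

/-! ### Entry relations in maximal tensor products. -/

theorem MaxTensor.tmul_zero {A B : Type} [CStarAlgebra A] [CStarAlgebra B] (a : A) :
    a ⊠ (0 : B) = 0 := by
  rw [tmul, TensorProduct.tmul_zero, map_zero]

theorem MaxTensor.tmul_pow {A B : Type} [CStarAlgebra A] [CStarAlgebra B] (a : A) (b : B) (n : ℕ) :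
    (a ⊠ b) ^ n = (a ^ n) ⊠ (b ^ n) := by
  induction n with
  | zero => simp [one_tmul_one]
  | succ n ih => rw [pow_succ, ih, tmul_mul_tmul, pow_succ, pow_succ]

theorem IsHEntry.tmul {A B : Type} [CStarAlgebra A] [CStarAlgebra B] {s : ℕ∞} {a : A} {b : B}
    (ha : IsHEntry s a) (hb : IsHEntry s b) : IsHEntry s (a ⊠ b) where
  normal := by simp only [MaxTensor.star_tmul, MaxTensor.tmul_mul_tmul, ha.normal, hb.normal]
  idem := by simp only [MaxTensor.star_tmul, MaxTensor.tmul_mul_tmul, ha.idem, hb.idem]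
  pow k hk hs := by
    rw [MaxTensor.tmul_pow, MaxTensor.star_tmul, MaxTensor.tmul_mul_tmul, ha.pow k hk hs,
      hb.pow k hk hs]

theorem CH.isHEntry_coord (s : ℕ∞) (N : ℕ) (i j : Fin N) : IsHEntry s (CH.coord s N i j) :=
  isHEntry_of_HRel (fun _ _ h => CH.isHGroup_coord s N _ _ (.entry h)) i j

/-! ### Column relations of the free complex reflection groups -/

namespace CH

variable (s : ℕ∞) (N : ℕ)

/-- The diagonal entries are the column sums of the projections `p_ij`. Off the diagonal every
single term vanishes, since its two factors lie in the same row and are orthogonal there. -/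
theorem transpose_mul_map_star : (coord s N).transpose * (coord s N).map star = 1 := by
  have hu := isHGroup_coord s N
  ext k l
  simp only [Matrix.mul_apply, Matrix.transpose_apply, Matrix.map_apply]
  by_cases h : k = l
  · subst h
    rw [Matrix.one_apply_eq, hu _ _ (.col k)]
  · rw [Matrix.one_apply_ne h]
    exact Finset.sum_eq_zero fun i _ => (hu.row_orthogonal i k l h).2.1

theorem conjTranspose_mul_self : (coord s N).conjTranspose * coord s N = 1 := by
  have hu := isHGroup_coord s N
  ext k l
  simp only [Matrix.mul_apply, Matrix.conjTranspose_apply]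
  by_cases h : k = l
  · subst h
    -- The diagonal sum involves `u* u`; normality turns it into the column sum of `u u*`.
    simp only [hu.normal]
    rw [Matrix.one_apply_eq, hu _ _ (.col k)]
  · rw [Matrix.one_apply_ne h]
    exact Finset.sum_eq_zero fun i _ => (hu.row_orthogonal i k l h).2.2

end CH

/-! ### Projections of given trace -/

section Proj

variable {A B : Type} [Ring A] [StarRing A] [Ring B] [StarRing B] {L M : ℕ}

/-- The matrix `p` is a projection of trace `L`. -/
structure IsProjOfTrace (L : ℕ) (p : Matrix (Fin M) (Fin M) B) : Prop where
  idem : p * p = p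
  selfAdjoint : p.conjTranspose = p
  trace : p.trace = L

theorem IsProjOfTrace.eq_of_rel {p : Matrix (Fin M) (Fin M) B} (h : IsProjOfTrace L p) {x y : B}
    (hxy : ProjOfTraceRel L p x y) : x = y := by
  obtain ⟨i, j⟩ | ⟨i, j⟩ | - := hxy
  · rw [h.idem]
  · rw [h.selfAdjoint]
  · exact h.trace

/-- This lemma and the next pass between relations on elements, as the universal property needs
them, and matrix equations, on which the computations with projections are done. -/
theorem isProjOfTrace_map [Algebra ℂ A] [Algebra ℂ B] {p : Matrix (Fin M) (Fin M) A}
    (π : A →⋆ₐ[ℂ] B) (h : ∀ x y, ProjOfTraceRel L p x y → π x = π y) :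
    IsProjOfTrace L (p.map π) where
  idem := by
    ext i j
    simpa [Matrix.mul_apply] using h _ _ (.idem i j)
  selfAdjoint := by
    ext i j
    simpa [map_star] using h _ _ (.selfAdjoint i j)
  trace := by
    simpa [Matrix.trace] using h _ _ .trace

theorem rel_of_isProjOfTrace_map [Algebra ℂ A] [Algebra ℂ B] {p : Matrix (Fin M) (Fin M) A}
    (π : A →⋆ₐ[ℂ] B) (h : IsProjOfTrace L (p.map π)) {x y : A} (hxy : ProjOfTraceRel L p x y) :
    π x = π y := by
  obtain ⟨i, j⟩ | ⟨i, j⟩ | - := hxy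
  · simpa [Matrix.mul_apply] using congrFun (congrFun h.idem i) j
  · simpa [map_star] using congrFun (congrFun h.selfAdjoint i) j
  · simpa [Matrix.trace] using h.trace

/-- Conjugation by a matrix with unitary-type column relations, whose entries commute with those of
the projection. -/
theorem IsProjOfTrace.conj {p w : Matrix (Fin M) (Fin M) B} (h : IsProjOfTrace L p)
    (hw : w.conjTranspose * w = 1) (hw' : w.transpose * w.map star = 1)
    (hc : ∀ i j k l, Commute (w i j) (p k l)) : IsProjOfTrace L (w * p * w.conjTranspose) where
  idem := by
    calc w * p * w.conjTranspose * (w * p * w.conjTranspose)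
        = w * p * (w.conjTranspose * w) * p * w.conjTranspose := by simp only [Matrix.mul_assoc]
      _ = _ := by rw [hw, Matrix.mul_one, Matrix.mul_assoc w, h.idem]
  selfAdjoint := by
    rw [Matrix.conjTranspose_mul, Matrix.conjTranspose_mul, Matrix.conjTranspose_conjTranspose,
      h.selfAdjoint, Matrix.mul_assoc]
  trace := by
    have e : ∀ k l, ∑ i, w i k * star (w i l) = (1 : Matrix (Fin M) (Fin M) B) k l := fun k l => by
      rw [← hw']; simp [Matrix.mul_apply]
    -- Moving `w i k` past `p k l` leaves the sum over `i` of `w i k * star (w i l)`, the `(k, l)`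
    -- entry of `wᵗ w̄ = 1`, so only the diagonal of `p` survives.
    calc (w * p * w.conjTranspose).trace
        = ∑ i, ∑ l, ∑ k, p k l * (w i k * star (w i l)) := by
          simp only [Matrix.trace, Matrix.diag, Matrix.mul_apply, Matrix.conjTranspose_apply,
            Finset.sum_mul]
          refine Finset.sum_congr rfl fun i _ => Finset.sum_congr rfl fun l _ =>
            Finset.sum_congr rfl fun k _ => ?_
          rw [(hc i k k l).eq, mul_assoc]
      _ = ∑ l, ∑ k, p k l * ∑ i, w i k * star (w i l) := by
          simp only [Finset.mul_sum]
          rw [Finset.sum_comm]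
          exact Finset.sum_congr rfl fun l _ => Finset.sum_comm
      _ = L := by
          simp only [e, Matrix.one_apply, mul_ite, mul_one, mul_zero, Finset.sum_ite_eq',
            Finset.mem_univ, if_true]
          exact h.trace

end Proj

/-! ### The universal property of the free spaces of partial isometries -/

/-- The matrix `v` satisfies the defining relations of `H_{MN}^{sL+}`. -/
structure IsHSpace {B : Type} [Ring B] [StarRing B] {M N : ℕ} (s : ℕ∞) (L : ℕ)
    (v : Matrix (Fin M) (Fin N) B) : Prop where
  proj : IsProjOfTrace L (v * v.conjTranspose)
  projBar : IsProjOfTrace L (v.map star * v.transpose)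
  entry : ∀ i j, IsHEntry s (v i j)

namespace CHSpace

variable {s : ℕ∞} {L M N : ℕ}

theorem map_mul_conjTranspose {A B : Type} [Ring A] [StarRing A] [Algebra ℂ A] [Ring B]
    [StarRing B] [Algebra ℂ B] (π : A →⋆ₐ[ℂ] B) (u : Matrix (Fin M) (Fin N) A) :
    (u * u.conjTranspose).map π = u.map π * (u.map π).conjTranspose := by
  ext i j; simp [Matrix.mul_apply, map_star]

theorem map_star_mul_transpose {A B : Type} [Ring A] [StarRing A] [Algebra ℂ A] [Ring B]
    [StarRing B] [Algebra ℂ B] (π : A →⋆ₐ[ℂ] B) (u : Matrix (Fin M) (Fin N) A) :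
    (u.map star * u.transpose).map π = (u.map π).map star * (u.map π).transpose := by
  ext i j; simp [Matrix.mul_apply, map_star]

/-- The canonical map from the free *-algebra. -/
def ofFree (s : ℕ∞) (L M N : ℕ) : FreeStar (Fin M × Fin N) →⋆ₐ[ℂ] CHSpace s L M N :=
  (ofCU s L M N).comp (UnivCStar.mk (isBddRel_URel L M N))

theorem coord_eq_map : coord s L M N = (genMatrix M N).map (ofFree s L M N) := rfl

/-- `C(X)` is built in two stages, each a completion of the previous algebra, and density composes
along the continuous outer map. It reduces later statements to *-polynomials in the coordinates. -/
theorem denseRange_ofFree : DenseRange (ofFree s L M N) := by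
  have h1 : DenseRange (ofCU s L M N) :=
    UnivCStar.denseRange_mk (R := HRel s (CU.coord L M N)) (isBddRel_of_cstar _)
  exact h1.comp (UnivCStar.denseRange_mk (isBddRel_URel L M N)) (continuous_starAlgHom _)

theorem isHSpace_coord : IsHSpace s L (coord s L M N) where
  proj := by
    rw [coord_eq_map, ← map_mul_conjTranspose]
    exact isProjOfTrace_map _ fun x y h => congrArg (ofCU s L M N)
      (UnivCStar.mk_eq_of_rel (isBddRel_URel L M N) (Or.inl h))
  projBar := by
    rw [coord_eq_map, ← map_star_mul_transpose]
    exact isProjOfTrace_map _ fun x y h => congrArg (ofCU s L M N)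
      (UnivCStar.mk_eq_of_rel (isBddRel_URel L M N) (Or.inr h))
  entry i j := by
    have h : ∀ x y, HRel s (CU.coord L M N) x y → ofCU s L M N x = ofCU s L M N y :=
      fun x y h => UnivCStar.mk_eq_of_rel _ h
    refine ⟨?_, ?_, fun k hk hs => ?_⟩
    · simpa [coord, map_star] using h _ _ (.normal i j)
    · simpa [coord, map_star] using h _ _ (.idem i j)
    · simpa [coord, map_star] using h _ _ (.pow i j k hk hs)

theorem URel_lift {B : Type} [CStarAlgebra B] {v : Matrix (Fin M) (Fin N) B}
    (hv : IsHSpace s L v) {x y : FreeStar (Fin M × Fin N)} (h : URel L M N x y) :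
    FreeStar.lift (fun t => v t.1 t.2) x = FreeStar.lift (fun t => v t.1 t.2) y := by
  have e : (genMatrix M N).map (FreeStar.lift fun t => v t.1 t.2) = v := by
    ext i j; simp [genMatrix]
  rcases h with h | h
  · refine rel_of_isProjOfTrace_map _ ?_ h
    rw [map_mul_conjTranspose, e]; exact hv.proj
  · refine rel_of_isProjOfTrace_map _ ?_ h
    rw [map_star_mul_transpose, e]; exact hv.projBar

/-- The map on `C(U_{MN}^{L+})` induced by a matrix satisfying the relations. -/
def liftCU {B : Type} [CStarAlgebra B] (v : Matrix (Fin M) (Fin N) B) (hv : IsHSpace s L v) :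
    CU L M N →⋆ₐ[ℂ] B :=
  UnivCStar.lift (isBddRel_URel L M N) (FreeStar.lift fun t => v t.1 t.2)
    fun _ _ h => URel_lift hv h

theorem liftCU_coord {B : Type} [CStarAlgebra B] (v : Matrix (Fin M) (Fin N) B)
    (hv : IsHSpace s L v) (i : Fin M) (j : Fin N) : liftCU v hv (CU.coord L M N i j) = v i j :=
  (UnivCStar.lift_mk _ _ _ _).trans (FreeStar.lift_gen _ _)

/-- Universal property of `C(H_{MN}^{sL+})`. -/
def lift {B : Type} [CStarAlgebra B] (v : Matrix (Fin M) (Fin N) B) (hv : IsHSpace s L v) :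
    CHSpace s L M N →⋆ₐ[ℂ] B :=
  UnivCStar.lift (isBddRel_of_cstar _) (liftCU v hv) (by
    rintro x y (⟨i, j⟩ | ⟨i, j⟩ | ⟨i, j⟩ | ⟨i, j, k, hk, hs⟩)
    · simpa [map_star, liftCU_coord] using (hv.entry i j).normal
    · simpa [map_star, liftCU_coord] using (hv.entry i j).idem
    -- Self-adjointness of `x x*` holds in any *-ring, which is why `IsHEntry` does not record it.
    · rw [star_mul, star_star]
    · simpa [map_star, liftCU_coord] using (hv.entry i j).pow k hk hs)

@[simp]
theorem lift_coord {B : Type} [CStarAlgebra B] (v : Matrix (Fin M) (Fin N) B)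
    (hv : IsHSpace s L v) (i : Fin M) (j : Fin N) : lift v hv (coord s L M N i j) = v i j :=
  (UnivCStar.lift_mk _ _ _ _).trans (liftCU_coord v hv i j)

/-- By continuity, agreement on *-polynomials suffices. The equalizer is used as a plain subalgebra,
so adjoints of the coordinates are checked separately. -/
theorem hom_ext {B : Type} [CStarAlgebra B] {f g : CHSpace s L M N →⋆ₐ[ℂ] B}
    (h : ∀ i j, f (coord s L M N i j) = g (coord s L M N i j)) : f = g := by
  refine StarAlgHom.ext fun x => denseRange_ofFree.induction_on (p := fun x => f x = g x) x
    (isClosed_eq (continuous_starAlgHom f) (continuous_starAlgHom g)) fun a => ?_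
  refine FreeStar.mem_of_gen (AlgHom.equalizer (f.comp (ofFree s L M N)).toAlgHom
    (g.comp (ofFree s L M N)).toAlgHom) (fun t => h t.1 t.2) (fun t => ?_) a
  change f (ofFree s L M N (star _)) = g (ofFree s L M N (star _))
  rw [map_star, map_star, map_star]
  exact congrArg star (h t.1 t.2)

end CHSpace
end FreeSpaces

namespace FreeSpaces
namespace CHSpace

variable (s : ℕ∞) (L M N : ℕ)

/-! ### The action map -/

/-- The matrix `∑ k l, a_ik ⊗ b_jl* ⊗ u_kl`. -/
def actionMatrix : Matrix (Fin M) (Fin N) (MaxTensor (CHProd s M N) (CHSpace s L M N)) :=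
  Matrix.of fun i j => ∑ k, ∑ l, (CH.coord s M i k ⊠ star (CH.coord s N j l)) ⊠ coord s L M N k l

/-- The coordinates of the first factor, in `C(H_M^{s+} × H_N^{s+}) ⊗ C(H_{MN}^{sL+})`. -/
def leftMatrix : Matrix (Fin M) (Fin M) (MaxTensor (CHProd s M N) (CHSpace s L M N)) :=
  (CH.coord s M).map (MaxTensor.inl.comp MaxTensor.inl)

/-- The coordinates of the second factor, in `C(H_M^{s+} × H_N^{s+}) ⊗ C(H_{MN}^{sL+})`. -/
def rightMatrix : Matrix (Fin N) (Fin N) (MaxTensor (CHProd s M N) (CHSpace s L M N)) :=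
  (CH.coord s N).map (MaxTensor.inl.comp MaxTensor.inr)

/-- The coordinates of the third factor, in `C(H_M^{s+} × H_N^{s+}) ⊗ C(H_{MN}^{sL+})`. -/
def midMatrix : Matrix (Fin M) (Fin N) (MaxTensor (CHProd s M N) (CHSpace s L M N)) :=
  (coord s L M N).map MaxTensor.inr

theorem leftMatrix_apply (i k : Fin M) :
    leftMatrix s L M N i k = (CH.coord s M i k ⊠ 1) ⊠ 1 := rfl

theorem rightMatrix_apply (j l : Fin N) :
    rightMatrix s L M N j l = (1 ⊠ CH.coord s N j l) ⊠ 1 := rfl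

theorem midMatrix_apply (k : Fin M) (l : Fin N) :
    midMatrix s L M N k l = 1 ⊠ coord s L M N k l := rfl

/-- This factorization `a u b*` turns the projection relations into products of matrices in which
`b* b` can cancel. -/
theorem actionMatrix_eq : actionMatrix s L M N =
    leftMatrix s L M N * midMatrix s L M N * (rightMatrix s L M N).conjTranspose := by
  ext i j
  simp only [actionMatrix, Matrix.of_apply, Matrix.mul_apply, Matrix.conjTranspose_apply,
    leftMatrix_apply, rightMatrix_apply, midMatrix_apply, Finset.sum_mul,
    MaxTensor.tmul_mul_tmul, MaxTensor.star_tmul, star_one, mul_one, one_mul]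
  exact Finset.sum_comm

/-- Entrywise adjoints of a matrix product normally reverse the factors inside each entry. Here the
three factors occupy different tensor legs, so the order can be kept. -/
theorem actionMatrix_map_star : (actionMatrix s L M N).map star =
    (leftMatrix s L M N).map star * (midMatrix s L M N).map star *
      (rightMatrix s L M N).transpose := by
  ext i j
  simp only [actionMatrix, Matrix.of_apply, Matrix.mul_apply, Matrix.transpose_apply,
    Matrix.map_apply, star_sum, leftMatrix_apply, rightMatrix_apply, midMatrix_apply,
    Finset.sum_mul, MaxTensor.tmul_mul_tmul, MaxTensor.star_tmul, star_one, mul_one, one_mul,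
    star_star]
  exact Finset.sum_comm

theorem map_conjTranspose_mul_self {A B : Type} [CStarAlgebra A] [CStarAlgebra B] {n : ℕ}
    {u : Matrix (Fin n) (Fin n) A} (f : A →⋆ₐ[ℂ] B) (h : u.conjTranspose * u = 1) :
    (u.map f).conjTranspose * u.map f = 1 := by
  have := congrArg (fun m => m.map f) h
  ext i j
  simpa [Matrix.mul_apply, map_star, Matrix.one_apply, apply_ite f] using
    congrFun (congrFun this i) j

theorem map_transpose_mul_map_star {A B : Type} [CStarAlgebra A] [CStarAlgebra B] {n : ℕ}
    {u : Matrix (Fin n) (Fin n) A} (f : A →⋆ₐ[ℂ] B) (h : u.transpose * u.map star = 1) :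
    (u.map f).transpose * (u.map f).map star = 1 := by
  have := congrArg (fun m => m.map f) h
  ext i j
  simpa [Matrix.mul_apply, map_star, Matrix.one_apply, apply_ite f] using
    congrFun (congrFun this i) j

theorem leftMatrix_conjTranspose_mul_self :
    (leftMatrix s L M N).conjTranspose * leftMatrix s L M N = 1 :=
  map_conjTranspose_mul_self _ (CH.conjTranspose_mul_self s M)

theorem leftMatrix_transpose_mul :
    (leftMatrix s L M N).transpose * (leftMatrix s L M N).map star = 1 :=
  map_transpose_mul_map_star _ (CH.transpose_mul_map_star s M)

theorem rightMatrix_conjTranspose_mul_self :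
    (rightMatrix s L M N).conjTranspose * rightMatrix s L M N = 1 :=
  map_conjTranspose_mul_self _ (CH.conjTranspose_mul_self s N)

theorem rightMatrix_transpose_mul :
    (rightMatrix s L M N).transpose * (rightMatrix s L M N).map star = 1 :=
  map_transpose_mul_map_star _ (CH.transpose_mul_map_star s N)

theorem isHSpace_midMatrix : IsHSpace s L (midMatrix s L M N) where
  proj := by
    rw [midMatrix, ← map_mul_conjTranspose]
    exact isProjOfTrace_map _ fun x y h => congrArg _ (isHSpace_coord.proj.eq_of_rel h)
  projBar := by
    rw [midMatrix, ← map_star_mul_transpose]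
    exact isProjOfTrace_map _ fun x y h => congrArg _ (isHSpace_coord.projBar.eq_of_rel h)
  entry i j := (show IsHEntry s (1 : CHProd s M N) from isHEntry_one).tmul (isHSpace_coord.entry i j)

theorem commute_leftMatrix_inr (i k : Fin M) (x : CHSpace s L M N) :
    Commute (leftMatrix s L M N i k) (MaxTensor.inr x) :=
  MaxTensor.commute_inl_inr (CH.coord s M i k ⊠ 1) x

theorem isHEntry_actionMatrix (i : Fin M) (j : Fin N) : IsHEntry s (actionMatrix s L M N i j) := by
  have hM := CH.isHGroup_coord s M
  have hN := CH.isHGroup_coord s N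
  -- The double sum becomes one sum over pairs `(k, l)`. Distinct pairs differ in some coordinate,
  -- and then row orthogonality kills the corresponding leg of the product.
  rw [actionMatrix, Matrix.of_apply, ← Fintype.sum_prod_type']
  have hz : ∀ (a a' : CH s M) (b b' : CH s N) (x x' : CHSpace s L M N),
      a * a' = 0 ∨ b * b' = 0 → ((a ⊠ b) ⊠ x) * ((a' ⊠ b') ⊠ x') = 0 := by
    rintro a a' b b' x x' (h | h)
    · rw [MaxTensor.tmul_mul_tmul, MaxTensor.tmul_mul_tmul, h, MaxTensor.zero_tmul,
        MaxTensor.zero_tmul]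
    · rw [MaxTensor.tmul_mul_tmul, MaxTensor.tmul_mul_tmul, h, MaxTensor.tmul_zero,
        MaxTensor.zero_tmul]
  have hne : ∀ t t' : Fin M × Fin N, t ≠ t' → t.1 ≠ t'.1 ∨ t.2 ≠ t'.2 := fun t t' h => by
    by_contra hc
    push Not at hc
    exact h (Prod.ext hc.1 hc.2)
  have hsN : ∀ k l, k ≠ l → star (CH.coord s N j k) * star (CH.coord s N j l) = 0 :=
    fun k l h => by rw [← star_mul, (hN.row_orthogonal j l k h.symm).1, star_zero]
  refine IsHEntry.sum (fun t => ?_) (fun t t' h => ?_) (fun t t' h => ?_) (fun t t' h => ?_)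
  · exact ((CH.isHEntry_coord s M i t.1).tmul (CH.isHEntry_coord s N j t.2).star).tmul
      (isHSpace_coord.entry t.1 t.2)
  · exact hz _ _ _ _ _ _ ((hne t t' h).imp (fun h => (hM.row_orthogonal i _ _ h).1) (hsN _ _))
  · simp only [MaxTensor.star_tmul, star_star]
    exact hz _ _ _ _ _ _ ((hne t t' h).imp (fun h => (hM.row_orthogonal i _ _ h).2.1)
      -- The second leg carries adjoints `b*`, so the two mixed orthogonality relations are used
      -- there in the opposite roles from the first leg.
      (fun h => (hN.row_orthogonal j _ _ h).2.2))
  · simp only [MaxTensor.star_tmul, star_star]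
    exact hz _ _ _ _ _ _ ((hne t t' h).imp (fun h => (hM.row_orthogonal i _ _ h).2.2)
      (fun h => (hN.row_orthogonal j _ _ h).2.1))

/-- In both projection conditions the coordinates of `b` cancel in the middle, leaving a conjugate
of a projection of `X` by `a`, respectively by `ā`. -/
theorem isHSpace_actionMatrix : IsHSpace s L (actionMatrix s L M N) where
  proj := by
    have e : actionMatrix s L M N * (actionMatrix s L M N).conjTranspose =
        leftMatrix s L M N * (midMatrix s L M N * (midMatrix s L M N).conjTranspose) *
          (leftMatrix s L M N).conjTranspose := by
      rw [actionMatrix_eq]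
      simp only [Matrix.conjTranspose_mul, Matrix.conjTranspose_conjTranspose, Matrix.mul_assoc]
      rw [← Matrix.mul_assoc (rightMatrix s L M N).conjTranspose (rightMatrix s L M N),
        rightMatrix_conjTranspose_mul_self, Matrix.one_mul]
    rw [e]
    refine (isHSpace_midMatrix s L M N).proj.conj (leftMatrix_conjTranspose_mul_self s L M N)
      (leftMatrix_transpose_mul s L M N) fun i j k l => ?_
    rw [midMatrix, ← map_mul_conjTranspose]
    exact commute_leftMatrix_inr s L M N i j _
  projBar := by
    have et : (actionMatrix s L M N).transpose = ((actionMatrix s L M N).map star).conjTranspose := by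
      ext i j; simp
    have em : (midMatrix s L M N).transpose = ((midMatrix s L M N).map star).conjTranspose := by
      ext i j; simp
    have el : ((leftMatrix s L M N).map star).conjTranspose = (leftMatrix s L M N).transpose := by
      ext i j; simp
    have er : (rightMatrix s L M N).transpose.conjTranspose = (rightMatrix s L M N).map star := by
      ext i j; simp
    have e : (actionMatrix s L M N).map star * (actionMatrix s L M N).transpose =
        (leftMatrix s L M N).map star * ((midMatrix s L M N).map star *
          (midMatrix s L M N).transpose) * ((leftMatrix s L M N).map star).conjTranspose := by
      rw [et, actionMatrix_map_star, em]
      simp only [Matrix.conjTranspose_mul, er, Matrix.mul_assoc]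
      rw [← Matrix.mul_assoc (rightMatrix s L M N).transpose ((rightMatrix s L M N).map star),
        rightMatrix_transpose_mul, Matrix.one_mul]
    rw [e]
    -- Conjugation is now by `ā`, for which the two column relations `a* a = 1` and `aᵗ ā = 1`
    -- exchange roles.
    refine (isHSpace_midMatrix s L M N).projBar.conj ?_ ?_ fun i j k l => ?_
    · rw [el, leftMatrix_transpose_mul]
    · rw [← leftMatrix_conjTranspose_mul_self s L M N]
      congr 1
      ext i j; simp
    · rw [midMatrix, ← map_star_mul_transpose]
      -- Commutation with the adjoint of a left coordinate comes from taking adjoints in the known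
      -- commutation, applied to the adjoint of the projection entry.
      have := (commute_leftMatrix_inr s L M N i j (star (((coord s L M N).map star *
        (coord s L M N).transpose) k l))).star_star
      rwa [← map_star, star_star] at this
  entry := isHEntry_actionMatrix s L M N

/-- The action map `u_ij ↦ ∑ k l, a_ik ⊗ b_jl* ⊗ u_kl`. -/
def action : CHSpace s L M N →⋆ₐ[ℂ] MaxTensor (CHProd s M N) (CHSpace s L M N) :=
  lift (actionMatrix s L M N) (isHSpace_actionMatrix s L M N)

theorem action_coord (i : Fin M) (j : Fin N) : action s L M N (coord s L M N i j) =
    ∑ k, ∑ l, (CH.coord s M i k ⊠ star (CH.coord s N j l)) ⊠ coord s L M N k l :=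
  lift_coord _ _ i j

/-! ### Coassociativity and counitality of the action. -/

theorem counit_coord (n : ℕ) (i j : Fin n) :
    CH.counit s n (CH.coord s n i j) = (1 : Matrix (Fin n) (Fin n) ℂ) i j :=
  CH.lift_coord _ _ i j

theorem prodCounit_tmul (a : CH s M) (b : CH s N) :
    CHProd.counit s M N (a ⊠ b) = CH.counit s M a * CH.counit s N b :=
  MaxTensor.lift_tmul _ _ _ a b

/-- The elements `a_ik ⊗ b_jl*` behave as the coefficients of one corepresentation indexed by pairs:
`Δ` preserves adjoints, and the flip pairs the legs. Both coassociativity and compatibility rest on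
this formula. -/
theorem prodComul_tmul_star (i k : Fin M) (j l : Fin N) :
    CHProd.comul s M N (CH.coord s M i k ⊠ star (CH.coord s N j l)) =
      ∑ p, ∑ q, (CH.coord s M i p ⊠ star (CH.coord s N j q)) ⊠
        (CH.coord s M p k ⊠ star (CH.coord s N q l)) := by
  rw [CHProd.comul, StarAlgHom.comp_apply, MaxTensor.map_tmul, map_star, CH.comul_coord,
    CH.comul_coord, star_sum, MaxTensor.sum_tmul, map_sum]
  simp only [MaxTensor.tmul_sum, map_sum, MaxTensor.star_tmul, MaxTensor.flipMid_tmul]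

theorem action_coassoc :
    (MaxTensor.assoc.comp (MaxTensor.map (CHProd.comul s M N)
      (StarAlgHom.id ℂ (CHSpace s L M N)))).comp (action s L M N) =
    (MaxTensor.map (StarAlgHom.id ℂ (CHProd s M N)) (action s L M N)).comp (action s L M N) := by
  refine hom_ext fun i j => ?_
  simp only [StarAlgHom.comp_apply, action_coord, map_sum, MaxTensor.map_tmul,
    prodComul_tmul_star, StarAlgHom.coe_id, id_eq, MaxTensor.sum_tmul, MaxTensor.assoc_tmul,
    MaxTensor.tmul_sum]
  -- The two sides now have the same terms; only the order of the four summations differs.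
  calc _ = ∑ k, ∑ p, ∑ l, ∑ q, (CH.coord s M i p ⊠ star (CH.coord s N j q)) ⊠
        ((CH.coord s M p k ⊠ star (CH.coord s N q l)) ⊠ coord s L M N k l) :=
        Finset.sum_congr rfl fun k _ => Finset.sum_comm
    _ = ∑ p, ∑ k, ∑ q, ∑ l, (CH.coord s M i p ⊠ star (CH.coord s N j q)) ⊠
        ((CH.coord s M p k ⊠ star (CH.coord s N q l)) ⊠ coord s L M N k l) := by
        rw [Finset.sum_comm]
        exact Finset.sum_congr rfl fun p _ => Finset.sum_congr rfl fun k _ => Finset.sum_comm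
    _ = _ := Finset.sum_congr rfl fun p _ => Finset.sum_comm

theorem action_counit : (MaxTensor.slice (CHProd.counit s M N)).comp (action s L M N) =
    StarAlgHom.id ℂ (CHSpace s L M N) := by
  refine hom_ext fun i j => ?_
  rw [StarAlgHom.comp_apply, action_coord, map_sum]
  have e : ∀ k l, MaxTensor.slice (CHProd.counit s M N)
      ((CH.coord s M i k ⊠ star (CH.coord s N j l)) ⊠ coord s L M N k l) =
        if k = i then (if l = j then coord s L M N k l else 0) else 0 := fun k l => by
    rw [MaxTensor.slice_tmul, prodCounit_tmul, map_star, counit_coord,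
      counit_coord]
    by_cases hk : k = i <;> by_cases hl : l = j <;>
      simp [Matrix.one_apply, @eq_comm _ i k, @eq_comm _ j l, hk, hl]
  simp only [map_sum, e]
  simp

/-! ### Density -/

/-- The matrices `a'`, `b'` invert the coefficients of the action, so summing over `i` and `j`
isolates one coordinate. Arbitrary matrices are allowed because the formula is needed both for the
coordinates and for their adjoints. -/
theorem sum_mul_tmul_one {A B X : Type} [CStarAlgebra A] [CStarAlgebra B] [CStarAlgebra X]
    {M N : ℕ} (a a' : Matrix (Fin M) (Fin M) A) (b b' : Matrix (Fin N) (Fin N) B)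
    (u : Matrix (Fin M) (Fin N) X) (ha : a.transpose * a' = 1) (hb : b.transpose * b' = 1)
    (k : Fin M) (l : Fin N) :
    ∑ i, ∑ j, (∑ p, ∑ q, (a i p ⊠ b j q) ⊠ u p q) * ((a' i k ⊠ b' j l) ⊠ 1) =
      (1 : MaxTensor A B) ⊠ u k l := by
  have ha' : ∀ p, ∑ i, a i p * a' i k = (1 : Matrix (Fin M) (Fin M) A) p k := fun p => by
    rw [← ha]; rfl
  have hb' : ∀ q, ∑ j, b j q * b' j l = (1 : Matrix (Fin N) (Fin N) B) q l := fun q => by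
    rw [← hb]; rfl
  calc _ = ∑ i, ∑ j, ∑ p, ∑ q, ((a i p * a' i k) ⊠ (b j q * b' j l)) ⊠ u p q := by
        simp only [Finset.sum_mul, MaxTensor.tmul_mul_tmul, mul_one]
    _ = ∑ i, ∑ p, ∑ q, ∑ j, ((a i p * a' i k) ⊠ (b j q * b' j l)) ⊠ u p q := by
        refine Finset.sum_congr rfl fun i _ => ?_
        rw [Finset.sum_comm]
        exact Finset.sum_congr rfl fun p _ => Finset.sum_comm
    _ = ∑ p, ∑ q, ∑ i, ∑ j, ((a i p * a' i k) ⊠ (b j q * b' j l)) ⊠ u p q := by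
        rw [Finset.sum_comm]
        exact Finset.sum_congr rfl fun p _ => Finset.sum_comm
    _ = ∑ p, ∑ q, ((1 : Matrix (Fin M) (Fin M) A) p k ⊠ (1 : Matrix (Fin N) (Fin N) B) q l) ⊠
          u p q := by
        simp only [← MaxTensor.sum_tmul, ← MaxTensor.tmul_sum, ha', hb']
    _ = _ := by
        rw [Finset.sum_eq_single k, Finset.sum_eq_single l, Matrix.one_apply_eq,
          Matrix.one_apply_eq, MaxTensor.one_tmul_one]
        · intro q _ hq
          rw [Matrix.one_apply_ne hq, MaxTensor.tmul_zero, MaxTensor.zero_tmul]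
        · simp
        · intro p _ hp
          refine Finset.sum_eq_zero fun q _ => ?_
          rw [Matrix.one_apply_ne hp, MaxTensor.zero_tmul, MaxTensor.zero_tmul]
        · simp

/-! ### The density condition for a general map `Φ`. -/

section Span

variable {G X : Type} [CStarAlgebra G] [CStarAlgebra X] (Φ : X →⋆ₐ[ℂ] MaxTensor G X)

/-- The linear span of the products `Φ(x) (g ⊗ 1)`. -/
def coactionSpan : Submodule ℂ (MaxTensor G X) :=
  Submodule.span ℂ {z : MaxTensor G X | ∃ (x : X) (g : G), z = Φ x * (g ⊠ 1)}

variable {Φ}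

theorem mul_tmul_one_mem_coactionSpan {z : MaxTensor G X} (hz : z ∈ coactionSpan Φ) (g : G) :
    z * (g ⊠ 1) ∈ coactionSpan Φ := by
  induction hz using Submodule.span_induction with
  | mem z hz =>
    obtain ⟨x, g', rfl⟩ := hz
    refine Submodule.subset_span ⟨x, g' * g, ?_⟩
    rw [mul_assoc, MaxTensor.tmul_mul_tmul, mul_one]
  | zero => rw [zero_mul]; exact Submodule.zero_mem _
  | add y z _ _ hy hz => rw [add_mul]; exact Submodule.add_mem _ hy hz
  | smul c z _ hz => rw [smul_mul_assoc]; exact Submodule.smul_mem _ c hz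

theorem map_mul_mem_coactionSpan {z : MaxTensor G X} (hz : z ∈ coactionSpan Φ) (x : X) :
    Φ x * z ∈ coactionSpan Φ := by
  induction hz using Submodule.span_induction with
  | mem z hz =>
    obtain ⟨x', g, rfl⟩ := hz
    refine Submodule.subset_span ⟨x * x', g, ?_⟩
    rw [map_mul, mul_assoc]
  | zero => rw [mul_zero]; exact Submodule.zero_mem _
  | add y z _ _ hy hz => rw [mul_add]; exact Submodule.add_mem _ hy hz
  | smul c z _ hz => rw [mul_smul_comm]; exact Submodule.smul_mem _ c hz

/-- The span absorbs `Φ(x)` on the left and `g ⊗ 1` on the right. As `1 ⊗ y` commutes with `g ⊗ 1`,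
the product `Φ(x)(g ⊗ 1)(1 ⊗ y)` is `Φ(x)(1 ⊗ y)(g ⊗ 1)`, which is covered by these two facts. This
gives the multiplicativity of `coactionSubalgebra`. -/
theorem mul_one_tmul_mem_coactionSpan {z : MaxTensor G X} (hz : z ∈ coactionSpan Φ) {y : X}
    (hy : (1 : G) ⊠ y ∈ coactionSpan Φ) : z * ((1 : G) ⊠ y) ∈ coactionSpan Φ := by
  induction hz using Submodule.span_induction with
  | mem z hz =>
    obtain ⟨x, g, rfl⟩ := hz
    have hc : (g ⊠ 1) * ((1 : G) ⊠ y) = (1 ⊠ y) * (g ⊠ 1) := MaxTensor.commute_inl_inr g y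
    rw [mul_assoc, hc, ← mul_assoc]
    exact mul_tmul_one_mem_coactionSpan (map_mul_mem_coactionSpan hy x) g
  | zero => rw [zero_mul]; exact Submodule.zero_mem _
  | add y z _ _ hy hz => rw [add_mul]; exact Submodule.add_mem _ hy hz
  | smul c z _ hz => rw [smul_mul_assoc]; exact Submodule.smul_mem _ c hz

variable (Φ) in
/-- The subalgebra of the elements `x` with `1 ⊗ x` in the span of the products `Φ(x) (g ⊗ 1)`. -/
def coactionSubalgebra : Subalgebra ℂ X where
  carrier := {x | (1 : G) ⊠ x ∈ coactionSpan Φ}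
  mul_mem' {x y} hx hy := by
    have : (1 : G) ⊠ (x * y) = ((1 : G) ⊠ x) * ((1 : G) ⊠ y) := by
      rw [MaxTensor.tmul_mul_tmul, mul_one]
    rw [Set.mem_ofPred_eq, this]
    exact mul_one_tmul_mem_coactionSpan hx hy
  add_mem' {x y} hx hy := by
    have : (1 : G) ⊠ (x + y) = (1 : G) ⊠ x + (1 : G) ⊠ y := map_add MaxTensor.inr x y
    rw [Set.mem_ofPred_eq, this]
    exact Submodule.add_mem _ hx hy
  algebraMap_mem' c := by
    have h1 : (1 : MaxTensor G X) ∈ coactionSpan Φ :=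
      Submodule.subset_span ⟨1, 1, by rw [map_one, one_mul, MaxTensor.one_tmul_one]⟩
    have : (1 : G) ⊠ algebraMap ℂ X c = c • (1 : MaxTensor G X) :=
      (AlgHomClass.commutes (MaxTensor.inr (A := G) (B := X)) c).trans
        (Algebra.algebraMap_eq_smul_one c)
    rw [Set.mem_ofPred_eq, this]
    exact Submodule.smul_mem _ c h1

/-- Since `g ⊗ x = (1 ⊗ x)(g ⊗ 1)` is continuous in `x`, density in `X` puts every elementary tensor
in the closed span, and their linear combinations are dense. -/
theorem dense_coactionSpan (h : Dense (coactionSubalgebra Φ : Set X)) :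
    Dense (coactionSpan Φ : Set (MaxTensor G X)) := by
  have hg : ∀ (g : G) (x : X), g ⊠ x ∈ (coactionSpan Φ).topologicalClosure := fun g x => by
    have hc : Continuous fun x : X => (MaxTensor.inr x : MaxTensor G X) * MaxTensor.inl g :=
      (continuous_starAlgHom _).mul continuous_const
    have := hc.range_subset_closure_image_dense h ⟨x, rfl⟩
    rw [← MaxTensor.inl_mul_inr, (MaxTensor.commute_inl_inr g x).eq]
    refine closure_mono ?_ this
    rintro _ ⟨y, hy, rfl⟩
    exact mul_tmul_one_mem_coactionSpan hy g
  have ht : ∀ t, MaxTensor.ofTensor t ∈ (coactionSpan Φ).topologicalClosure := fun t => by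
    induction t using TensorProduct.induction_on with
    | zero => rw [map_zero]; exact Submodule.zero_mem _
    | add u v hu hv => rw [map_add]; exact Submodule.add_mem _ hu hv
    | tmul g x => exact hg g x
  refine dense_closure.1 (MaxTensor.denseRange_ofTensor.mono ?_)
  rintro _ ⟨t, rfl⟩
  exact ht t

end Span

theorem one_tmul_coord_mem (k : Fin M) (l : Fin N) :
    coord s L M N k l ∈ coactionSubalgebra (action s L M N) := by
  change _ ∈ coactionSpan (action s L M N)
  -- The coefficients `a_ip` and `b_jq*` of `Φ(u_ij)` are inverted by the multipliers `a_ik*` and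
  -- `b_jl`.
  rw [← sum_mul_tmul_one (CH.coord s M) ((CH.coord s M).map star) ((CH.coord s N).map star)
    (CH.coord s N) (coord s L M N) (CH.transpose_mul_map_star s M) (CH.conjTranspose_mul_self s N)]
  refine Submodule.sum_mem _ fun i _ => Submodule.sum_mem _ fun j _ => Submodule.subset_span
    ⟨coord s L M N i j, star (CH.coord s M i k) ⊠ CH.coord s N j l, ?_⟩
  rw [action_coord]
  rfl

/-- This does not follow formally from the case of the coordinates: the adjoint of `Φ(x)(g ⊗ 1)` has
its factors in the wrong order. The same summation is run again with the conjugate coefficients. -/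
theorem one_tmul_star_coord_mem (k : Fin M) (l : Fin N) :
    star (coord s L M N k l) ∈ coactionSubalgebra (action s L M N) := by
  change _ ∈ coactionSpan (action s L M N)
  rw [← Matrix.map_apply (f := star),
    ← sum_mul_tmul_one ((CH.coord s M).map star) (CH.coord s M) (CH.coord s N)
    ((CH.coord s N).map star) ((coord s L M N).map star) (CH.conjTranspose_mul_self s M)
    (CH.transpose_mul_map_star s N)]
  refine Submodule.sum_mem _ fun i _ => Submodule.sum_mem _ fun j _ => Submodule.subset_span
    ⟨star (coord s L M N i j), CH.coord s M i k ⊠ star (CH.coord s N j l), ?_⟩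
  rw [map_star, action_coord]
  simp only [star_sum, MaxTensor.star_tmul, star_star, Matrix.map_apply]

theorem action_dense : Dense (coactionSpan (action s L M N) :
    Set (MaxTensor (CHProd s M N) (CHSpace s L M N))) := by
  refine dense_coactionSpan (denseRange_ofFree.mono ?_)
  rintro _ ⟨a, rfl⟩
  refine FreeStar.mem_of_gen ((coactionSubalgebra (action s L M N)).comap
    (ofFree s L M N).toAlgHom) (fun t => one_tmul_coord_mem s L M N t.1 t.2) (fun t => ?_) a
  change ofFree s L M N (star _) ∈ coactionSubalgebra (action s L M N)
  rw [map_star]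
  exact one_tmul_star_coord_mem s L M N t.1 t.2

theorem isCoaction_action :
    IsCoaction (CHProd.comul s M N) (CHProd.counit s M N) (action s L M N) where
  coassoc := action_coassoc s L M N
  counit := action_counit s L M N
  dense := action_dense s L M N

/-! ### The quotient map -/

section Quotient

variable {L M N} (hLM : L ≤ M) (hLN : L ≤ N)

/-- The matrix of the inclusion of the first `L` basis vectors. -/
def inclMatrix (h : L ≤ M) : Matrix (Fin M) (Fin L) ℂ :=
  Matrix.of fun k m => if k = m.castLE h then 1 else 0

theorem inclMatrix_transpose_mul_self (h : L ≤ M) :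
    (inclMatrix h).transpose * inclMatrix h = 1 := by
  ext m m'
  by_cases e : m = m' <;> simp [Matrix.mul_apply, inclMatrix, Matrix.one_apply, e, eq_comm]

theorem inclMatrix_map_star (h : L ≤ M) : (inclMatrix h).map star = inclMatrix h := by
  ext k m
  by_cases e : k = m.castLE h <;> simp [inclMatrix, e]

theorem inclMatrix_conjTranspose (h : L ≤ M) :
    (inclMatrix h).conjTranspose = (inclMatrix h).transpose :=
  congrArg Matrix.transpose (inclMatrix_map_star h)

/-- The base point of `H_{MN}^{sL+}`: the partial identity matrix of rank `L`. -/
def baseMatrix : Matrix (Fin M) (Fin N) ℂ := inclMatrix hLM * (inclMatrix hLN).transpose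

/-- The base point is a real matrix, so its two projection conditions coincide. -/
theorem baseMatrix_conjTranspose :
    (baseMatrix hLM hLN).conjTranspose = (baseMatrix hLM hLN).transpose := by
  rw [baseMatrix, Matrix.conjTranspose_mul, Matrix.transpose_mul, inclMatrix_conjTranspose,
    ← inclMatrix_conjTranspose hLN, Matrix.conjTranspose_conjTranspose, inclMatrix_conjTranspose,
    Matrix.transpose_transpose]

theorem baseMatrix_map_star : (baseMatrix hLM hLN).map star = baseMatrix hLM hLN :=
  congrArg Matrix.transpose (baseMatrix_conjTranspose hLM hLN)

/-- With `V`, `W` the inclusions of `ℂ^L` in `ℂ^M` and `ℂ^N`, the isometry relation `Wᵗ W = 1`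
reduces the product to `V Vᵗ`, the range projection of `V`. -/
theorem isProjOfTrace_baseMatrix :
    IsProjOfTrace L (baseMatrix hLM hLN * (baseMatrix hLM hLN).transpose) := by
  have e : baseMatrix hLM hLN * (baseMatrix hLM hLN).transpose =
      inclMatrix hLM * (inclMatrix hLM).transpose := by
    rw [baseMatrix, Matrix.transpose_mul, Matrix.transpose_transpose, Matrix.mul_assoc,
      ← Matrix.mul_assoc (inclMatrix hLN).transpose, inclMatrix_transpose_mul_self, Matrix.one_mul]
  rw [e]
  refine ⟨?_, ?_, ?_⟩
  · rw [Matrix.mul_assoc, ← Matrix.mul_assoc (inclMatrix hLM).transpose,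
      inclMatrix_transpose_mul_self, Matrix.one_mul]
  · rw [Matrix.conjTranspose_mul, ← inclMatrix_conjTranspose, Matrix.conjTranspose_conjTranspose]
  -- Over `ℂ` the trace is cyclic, so it equals that of `Vᵗ V`, the identity of size `L`.
  · rw [Matrix.trace_mul_comm, inclMatrix_transpose_mul_self, Matrix.trace_one, Fintype.card_fin]

theorem isHSpace_baseMatrix : IsHSpace s L (baseMatrix hLM hLN) where
  proj := by
    rw [baseMatrix_conjTranspose]
    exact isProjOfTrace_baseMatrix hLM hLN
  projBar := by
    rw [baseMatrix_map_star]
    exact isProjOfTrace_baseMatrix hLM hLN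
  entry i j := by
    rw [baseMatrix, Matrix.mul_apply]
    have h0 : ∀ m, inclMatrix hLM i m * (inclMatrix hLN).transpose m j =
        if i = m.castLE hLM ∧ j = m.castLE hLN then 1 else 0 := fun m => by
      by_cases h : i = m.castLE hLM <;> simp [inclMatrix, h]
    have hs : ∀ m, star (inclMatrix hLM i m * (inclMatrix hLN).transpose m j) =
        inclMatrix hLM i m * (inclMatrix hLN).transpose m j := fun m => by
      rw [h0]; split_ifs <;> simp
    -- At most one index `m` maps to `i`, so the `0`-`1` summands of an entry are orthogonal and
    -- `IsHEntry.sum` applies.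
    have hz : ∀ m m', m ≠ m' → (inclMatrix hLM i m * (inclMatrix hLN).transpose m j) *
        (inclMatrix hLM i m' * (inclMatrix hLN).transpose m' j) = 0 := fun m m' h => by
      rw [h0, h0]
      by_cases h1 : i = m.castLE hLM
      · have h2 : i ≠ m'.castLE hLM := fun h2 =>
          h (Fin.castLE_injective hLM (h1.symm.trans h2))
        simp [h2]
      · simp [h1]
    refine IsHEntry.sum (fun m => ?_) hz (fun m m' h => ?_) (fun m m' h => ?_)
    · rw [h0]; split_ifs
      · exact isHEntry_one
      · exact isHEntry_zero
    · rw [hs]; exact hz m m' h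
    · rw [hs]; exact hz m m' h

/-- The evaluation at the base point. -/
def basePoint : CHSpace s L M N →⋆ₐ[ℂ] ℂ :=
  lift (baseMatrix hLM hLN) (isHSpace_baseMatrix s hLM hLN)

/-- The slice map `id ⊗ φ`, for the evaluation `φ` at the base point. -/
def sliceBase : MaxTensor (CHProd s M N) (CHSpace s L M N) →⋆ₐ[ℂ] CHProd s M N :=
  MaxTensor.lift (StarAlgHom.id ℂ _) ((StarAlgHom.ofId ℂ _).comp (basePoint s hLM hLN))
    fun g x => (Algebra.commutes (basePoint s hLM hLN x) g).symm

theorem sliceBase_tmul (g : CHProd s M N) (x : CHSpace s L M N) :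
    sliceBase s hLM hLN (g ⊠ x) = basePoint s hLM hLN x • g := by
  rw [Algebra.smul_def, Algebra.commutes]
  exact MaxTensor.lift_tmul _ _ _ g x

/-- The quotient map, given by the orbit of the base point. -/
def quotientMap : CHSpace s L M N →⋆ₐ[ℂ] CHProd s M N :=
  (sliceBase s hLM hLN).comp (action s L M N)

theorem quotientMap_coord (i : Fin M) (j : Fin N) :
    quotientMap s hLM hLN (coord s L M N i j) =
      ∑ l : Fin L, CH.coord s M i (l.castLE hLM) ⊠ star (CH.coord s N j (l.castLE hLN)) := by
  -- The coefficient of the base point is kept as a sum over `m : Fin L`; for each `m` the sums over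
  -- `k` and `l` then collapse to one term, giving the required sum over `Fin L`.
  have e : ∀ k l, sliceBase s hLM hLN
      ((CH.coord s M i k ⊠ star (CH.coord s N j l)) ⊠ coord s L M N k l) =
      ∑ m : Fin L, if k = m.castLE hLM then (if l = m.castLE hLN then
        CH.coord s M i k ⊠ star (CH.coord s N j l) else 0) else 0 := fun k l => by
    have h2 : basePoint s hLM hLN (coord s L M N k l) = baseMatrix hLM hLN k l := lift_coord _ _ k l
    rw [sliceBase_tmul, h2, baseMatrix, Matrix.mul_apply, Finset.sum_smul]
    refine Finset.sum_congr rfl fun m _ => ?_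
    by_cases hk : k = m.castLE hLM <;> by_cases hl : l = m.castLE hLN <;>
      simp [inclMatrix, hk, hl]
  rw [quotientMap, StarAlgHom.comp_apply, action_coord]
  simp only [map_sum, e]
  calc _ = ∑ k, ∑ m : Fin L, ∑ l, if k = m.castLE hLM then (if l = m.castLE hLN then
        CH.coord s M i k ⊠ star (CH.coord s N j l) else 0) else 0 :=
        Finset.sum_congr rfl fun k _ => Finset.sum_comm
    _ = _ := by
        rw [Finset.sum_comm]
        refine Finset.sum_congr rfl fun m _ => ?_
        rw [Finset.sum_eq_single (m.castLE hLM), Finset.sum_eq_single (m.castLE hLN)]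
        · simp
        · intro l _ hl; simp [hl]
        · simp
        · intro k _ hk; simp [hk]
        · simp

/-- Conceptually, slicing `(id ⊗ Φ)Φ = (Δ ⊗ id)Φ` at the base point gives this identity. On
generators it again reduces to reordering sums, by `prodComul_tmul_star`. -/
theorem map_quotientMap_comp_action :
    (MaxTensor.map (StarAlgHom.id ℂ (CHProd s M N)) (quotientMap s hLM hLN)).comp (action s L M N) =
      (CHProd.comul s M N).comp (quotientMap s hLM hLN) := by
  refine hom_ext fun i j => ?_
  simp only [StarAlgHom.comp_apply, action_coord, quotientMap_coord, map_sum, MaxTensor.map_tmul,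
    prodComul_tmul_star, StarAlgHom.coe_id, id_eq, MaxTensor.tmul_sum]
  calc _ = ∑ k, ∑ m : Fin L, ∑ l, (CH.coord s M i k ⊠ star (CH.coord s N j l)) ⊠
        (CH.coord s M k (m.castLE hLM) ⊠ star (CH.coord s N l (m.castLE hLN))) :=
        Finset.sum_congr rfl fun k _ => Finset.sum_comm
    _ = _ := Finset.sum_comm

end Quotient
end CHSpace
end FreeSpaces

end

theorem proposition4p3 (s : ℕ∞) (hs : s = ⊤ ∨ ∃ r : ℕ, 0 < r ∧ s = ((2 * r : ℕ) : ℕ∞))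
    (L M N : ℕ) (hLM : L ≤ M) (hMN : M ≤ N) :
    ∃ (Φ : FreeSpaces.CHSpace s L M N →⋆ₐ[ℂ]
          FreeSpaces.MaxTensor (FreeSpaces.CHProd s M N) (FreeSpaces.CHSpace s L M N))
      (π : FreeSpaces.CHSpace s L M N →⋆ₐ[ℂ] FreeSpaces.CHProd s M N),
      -- the action map of `H_M^{s+} × H_N^{s+}`
      (∀ (i : Fin M) (j : Fin N), Φ (FreeSpaces.CHSpace.coord s L M N i j) =
        ∑ k : Fin M, ∑ l : Fin N,
          (FreeSpaces.CH.coord s M i k ⊠ star (FreeSpaces.CH.coord s N j l)) ⊠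
            FreeSpaces.CHSpace.coord s L M N k l) ∧
      FreeSpaces.IsCoaction (FreeSpaces.CHProd.comul s M N) (FreeSpaces.CHProd.counit s M N) Φ ∧
      -- the quotient map from `H_M^{s+} × H_N^{s+}`
      (∀ (i : Fin M) (j : Fin N), π (FreeSpaces.CHSpace.coord s L M N i j) =
        ∑ l : Fin L, FreeSpaces.CH.coord s M i (l.castLE hLM) ⊠
          star (FreeSpaces.CH.coord s N j (l.castLE (hLM.trans hMN)))) ∧
      -- the compatibility `a(g, p(g')) = p(g g')` of the two maps
      (FreeSpaces.MaxTensor.map (StarAlgHom.id ℂ (FreeSpaces.CHProd s M N)) π).comp Φ =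
        (FreeSpaces.CHProd.comul s M N).comp π := by
  exact ⟨FreeSpaces.CHSpace.action s L M N, FreeSpaces.CHSpace.quotientMap s hLM (hLM.trans hMN),
    FreeSpaces.CHSpace.action_coord s L M N, FreeSpaces.CHSpace.isCoaction_action s L M N,
    FreeSpaces.CHSpace.quotientMap_coord s hLM (hLM.trans hMN),
    FreeSpaces.CHSpace.map_quotientMap_comp_action s hLM (hLM.trans hMN)⟩
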